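/- Let $N\ge 1$, $c>0$, and let $G:\mathbb R^N\times\mathbb R\to\mathbb R$ be locally integrable. Points are written $(x,t)$, $u_{,j}=\partial u/\partial x_j$, $u_{,t}=\dot u=\partial u/\partial t$, and $\Box_c u=\Delta u-c^{-2}\,\partial^2u/\partial t^2$. *Wave fronts.* A point $p$ of a set $F\subset\mathbb R^{N+1}$ is a smooth point of $F$ if near $p$ the set $F$ is given by an equation $\Phi(x,t)=0$, where $\Phi$ is $C^1$ near $p$, $\nabla_x\Phi(p)\neq0$, and $\partial_t\Phi=-c\,\|\nabla_x\Phi\|$ at the points of $F$ near $p$ (so $F$ is a characteristic surface there, and moves with speed $c$ in the direction of the unit vector $n=\nabla_x\Phi/\|\nabla_x\Phi\|$). A wave front is a set $F$ that is the closure of the set of its smooth points and whose other points (edges, vertices) form a set of $N$-dimensional Hausdorff measure $0$. *Classical solutions.* A function $u:\mathbb R^N\times\mathbb R\to\mathbb R$ is a classical solution of $\Box_cu=G$ if there is a finite or countable, locally finite family of wave fronts $F_k$, with $\mathcal H^N(F_k\cap F_l)=0$ for $k\ne l$, such that 1. $u$ is $C^2$ and satisfies $\Box_cu=G$ pointwise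 off $\Sigma=\bigcup_kF_k$; 2. each point of $\mathbb R^{N+1}$ has a neighbourhood in which $u$ and its first derivatives are bounded off $\Sigma$; 3. at each smooth point of a front $F_k$ that lies on no other front, $u$ and its first derivatives have limits from each of the two sides of $F_k$, and Hadamard's conditions $$[u]=0,\qquad[\dot u+c\,n_i\,u_{,i}]=0$$ hold, where $[f](x,t)=\lim_{\varepsilon\to+0}\bigl(f(x+\varepsilon n,t)-f(x-\varepsilon n,t)\bigr)$, with $n=n(x,t)$ taken at the given point of the front. **Lemma 1.1.** If $u$ is a classical solution of $\Box_cu=G$, then $u$ is locally integrable and is a generalized solution: $$\int_{\mathbb R^{N+1}}u\,\Box_c\varphi\;dx\,dt=\int_{\mathbb R^{N+1}}G\,\varphi\;dx\,dt\qquad\text{for all }\varphi\in C_c^\infty(\mathbb R^{N+1}).$$ Moreover, no singular layers on the fronts appear under generalized differentiation: the pointwise derivatives $u_{,j}$ ($1\le j\le N$), $u_{,t}$ and the pointwise $\Box_cu$ (defined off $\Sigma$, hence almost everywhere) are locally integrable, and they are the generalized derivatives, respectively the generalized $\Box_cu$, of $u$; that is, for all $\varphi\in C_c^\infty(\mathbb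 R^{N+1})$, $$\int u\,\varphi_{,j}=-\int u_{,j}\,\varphi,\qquad\int u\,\varphi_{,t}=-\int u_{,t}\,\varphi,\qquad\int u\,\Box_c\varphi=\int(\Box_cu)\,\varphi .$$ -/

import Mathlib

open MeasureTheory Filter Topology
open scoped ContDiff

noncomputable section

namespace WaveEq

/-- Space-time `ℝ^N × ℝ`, with points `(x, t)`. -/
abbrev Spacetime (N : ℕ) : Type := EuclideanSpace ℝ (Fin N) × ℝ

variable {N : ℕ}

/-- The partial derivative `∂f/∂x_j`. -/
def dx (j : Fin N) (f : Spacetime N → ℝ) (p : Spacetime N) : ℝ :=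
  fderiv ℝ f p (EuclideanSpace.single j 1, 0)

/-- The partial derivative `∂f/∂t`. -/
def dt (f : Spacetime N → ℝ) (p : Spacetime N) : ℝ :=
  fderiv ℝ f p (0, 1)

/-- The spatial gradient `(∂f/∂x_1, …, ∂f/∂x_N)`. -/
def gradX (f : Spacetime N → ℝ) (p : Spacetime N) : EuclideanSpace ℝ (Fin N) :=
  WithLp.toLp 2 (fun j => dx j f p)

/-- The wave operator `□_c f = Δ f - c⁻² ∂²f/∂t²`, computed pointwise. -/
def box (c : ℝ) (f : Spacetime N → ℝ) (p : Spacetime N) : ℝ :=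
  ∑ j : Fin N, dx j (dx j f) p - 1 / c ^ 2 * dt (dt f) p

/-- `Φ = 0` is an equation of `F` near `p`, in which `Φ` is continuously differentiable with
non-zero spatial gradient, and `F` is a characteristic surface of the wave equation near `p`:
its normal `(∇_x Φ, Φ_t)` satisfies `Φ_t = -c ‖∇_x Φ‖`, so that `F` moves with speed `c` in the
direction of `∇_x Φ`. -/
structure IsFrontEquation (c : ℝ) (F : Set (Spacetime N)) (Φ : Spacetime N → ℝ)
    (p : Spacetime N) : Prop where
  contDiffAt : ContDiffAt ℝ 1 Φ p
  mem_iff : ∀ᶠ q in 𝓝 p, (q ∈ F ↔ Φ q = 0)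
  gradX_ne_zero : gradX Φ p ≠ 0
  characteristic : ∀ᶠ q in 𝓝 p, q ∈ F → dt Φ q = -c * ‖gradX Φ q‖

/-- The points of `F` near which `F` is a smooth (`C¹`) characteristic surface. -/
def smoothPart (c : ℝ) (F : Set (Spacetime N)) : Set (Spacetime N) :=
  {p | p ∈ F ∧ ∃ Φ : Spacetime N → ℝ, IsFrontEquation c F Φ p}

/-- A wave front: the closure of a characteristic surface. Edges, vertices and the like
are allowed, provided that they have zero `N`-dimensional Hausdorff measure. -/
structure IsWaveFront (c : ℝ) (F : Set (Spacetime N)) : Prop where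
  eq_closure : F = closure (smoothPart c F)
  singular_null : Measure.hausdorffMeasure (N : ℝ) (F \ smoothPart c F) = 0

/-- The unit normal `n = ∇_x Φ / ‖∇_x Φ‖` to the moving front `Φ = 0` in `ℝ^N`. -/
def unitNormal (Φ : Spacetime N → ℝ) (p : Spacetime N) : EuclideanSpace ℝ (Fin N) :=
  ‖gradX Φ p‖⁻¹ • gradX Φ p

/-- The jump of `f` at `p = (x, t)` in the direction `n` is `J`:
`f (x + ε n, t) - f (x - ε n, t) → J` as `ε → +0`. -/
def HasJump (f : Spacetime N → ℝ) (p : Spacetime N) (n : EuclideanSpace ℝ (Fin N)) (J : ℝ) :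
    Prop :=
  Tendsto (fun ε : ℝ => f (p.1 + ε • n, p.2) - f (p.1 - ε • n, p.2)) (𝓝[>] 0) (𝓝 J)

/-- `f` has (finite) limits at `p` from the two sides of the surface `Φ = 0`. -/
def HasSideLimits {Y : Type*} [TopologicalSpace Y] (f : Spacetime N → Y)
    (Φ : Spacetime N → ℝ) (p : Spacetime N) : Prop :=
  (∃ a, Tendsto f (𝓝[{q | 0 < Φ q}] p) (𝓝 a)) ∧ (∃ b, Tendsto f (𝓝[{q | Φ q < 0}] p) (𝓝 b))

/-- Hadamard's conditions `[u] = 0`, `[u_t + c n_i u_{,i}] = 0` at the point `p` of the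
front `Φ = 0`. -/
structure HadamardConditions (c : ℝ) (u Φ : Spacetime N → ℝ) (p : Spacetime N) : Prop where
  jump_zero : HasJump u p (unitNormal Φ p) 0
  jump_deriv_zero :
    HasJump (fun q => dt u q + c * ∑ i : Fin N, unitNormal Φ p i * dx i u q) p
      (unitNormal Φ p) 0

/-- `u` is a classical solution of `□_c u = G` whose wave fronts are `F 0, F 1, …`. Some of the
`F k` may be empty, so that the number of fronts is finite or countable. -/
structure IsClassicalSolutionWithFronts (c : ℝ) (G u : Spacetime N → ℝ)
    (F : ℕ → Set (Spacetime N)) : Prop where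
  isWaveFront : ∀ k, IsWaveFront c (F k)
  locallyFinite : LocallyFinite F
  inter_null : ∀ k l, k ≠ l → Measure.hausdorffMeasure (N : ℝ) (F k ∩ F l) = 0
  contDiffOn : ContDiffOn ℝ 2 u (⋃ k, F k)ᶜ
  equation : ∀ p ∉ ⋃ k, F k, box c u p = G p
  locallyBounded : ∀ p, ∃ M : ℝ, ∀ᶠ q in 𝓝 p, q ∉ ⋃ k, F k → |u q| ≤ M ∧ ‖fderiv ℝ u q‖ ≤ M
  sideLimits : ∀ k, ∀ p ∈ F k, (∀ l, l ≠ k → p ∉ F l) → ∀ Φ, IsFrontEquation c (F k) Φ p →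
    HasSideLimits u Φ p ∧ HasSideLimits (fderiv ℝ u) Φ p
  hadamard : ∀ k, ∀ p ∈ F k, (∀ l, l ≠ k → p ∉ F l) → ∀ Φ, IsFrontEquation c (F k) Φ p →
    HadamardConditions c u Φ p

/-- Classical solutions of `□_c u = G`: twice continuously differentiable solutions off
finitely or countably many wave fronts, on which Hadamard's conditions hold. -/
def IsClassicalSolution (c : ℝ) (G u : Spacetime N → ℝ) : Prop :=
  ∃ F : ℕ → Set (Spacetime N), IsClassicalSolutionWithFronts c G u F

/-- Test functions: infinitely differentiable with compact support. -/
def IsTestFunction (φ : Spacetime N → ℝ) : Prop :=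
  ContDiff ℝ ∞ φ ∧ HasCompactSupport φ

/-- The value `(f, φ)` of the regular generalized function of `f` on `φ`. -/
def pairing (f φ : Spacetime N → ℝ) : ℝ := ∫ p, f p * φ p

/-- The regular generalized function of the locally integrable function `u` satisfies
`□_c u = g` in the sense of generalized functions: `(u, □_c φ) = (g, φ)` for all `φ`. -/
structure IsGeneralizedSolution (c : ℝ) (g u : Spacetime N → ℝ) : Prop where
  locallyIntegrable : LocallyIntegrable u
  locallyIntegrable_rhs : LocallyIntegrable g
  weak : ∀ φ, IsTestFunction φ → pairing u (box c φ) = pairing g φ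

/-- The generalized derivative of `u` that is the transpose of `-D` on test functions is the
regular generalized function of the pointwise derivative `D u`: no singular layers appear. -/
structure NoLayers (D : (Spacetime N → ℝ) → Spacetime N → ℝ) (u : Spacetime N → ℝ) : Prop where
  locallyIntegrable : LocallyIntegrable (D u)
  weak : ∀ φ, IsTestFunction φ → pairing u (D φ) = -pairing (D u) φ

end WaveEq

end

open MeasureTheory Filter Topology
open scoped ContDiff

/-! Every claim is a divergence identity `∑ i, ∂(f i)/∂(e i) = g` for a field that is `C¹` off the
fronts; `divPairing` measures its weak defect. The one-component field `u` along a vector `v` gives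
the first derivatives. The field `(∇u, -c⁻² u_t)`, with divergence `G` off the fronts, gives the
wave equation once one more derivative is moved off the test function.

Such an identity holds weakly if the normal component of the field has equal limits on both sides of
each front. For `u` this is `[u] = 0`. For the wave field, `Φ_t = -c ‖∇_x Φ‖` turns the normal
component `∇u·∇_x Φ - c⁻² u_t Φ_t` into `(‖∇_x Φ‖ / c) (u_t + c n_i u_{,i})`, which is Hadamard's
second quantity (`exists_tendsto_flux`).

Second derivatives of `u` may be unbounded near a front, so no one-sided boundary integrals are
taken. Since `Φ_t ≠ 0`, a front is locally a graph `t = τ x`. The test function is multiplied by a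
cutoff vanishing in a thin layer about the graph; the derivative of the cutoff is a concentrating
kernel of mean zero in `t`, and a flux with equal side limits gives zero in the limit
(`divPairing_eq_zero_of_graph`).

Edges, vertices and intersections form a closed set with `H^N = 0` in dimension `N + 1`. Balls of
radii `r` covering a compact part with `∑ r^N` small carry a cutoff whose gradient has integral of
order `∑ r^(N+1) / r`, so bounded fields do not see this set
(`divPairing_eq_zero_of_hausdorffMeasure_eq_zero`). A partition of unity joins the local results in
`divPairing_eq_zero_of_fronts`. -/

namespace WaveEq

/-! ### Weak divergence equations and the smooth case -/

section DivPairing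

variable {E ι : Type*} [NormedAddCommGroup E] [NormedSpace ℝ E] [MeasurableSpace E] [Fintype ι]

/-- The defect `∫ (∑ i, f i * ∂ψ/∂(e i) + g * ψ)` of the equation `∑ i, ∂(f i)/∂(e i) = g`
in the sense of generalized functions. -/
noncomputable def divPairing (μ : Measure E) (f : ι → E → ℝ) (e : ι → E) (g ψ : E → ℝ) : ℝ :=
  ∫ x, ((∑ i, f i x * fderiv ℝ ψ x (e i)) + g x * ψ x) ∂μ

/-- Off its support `h` annihilates whatever `f` does, so fields that are regular only off the
fronts can be integrated against suitable test functions. -/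
theorem continuous_mul_of_tsupport_subset {X : Type*} [TopologicalSpace X] {f h : X → ℝ}
    {U : Set X} (hU : IsOpen U) (hf : ContinuousOn f U) (hh : Continuous h)
    (hs : tsupport h ⊆ U) : Continuous fun x => f x * h x := by
  refine continuous_of_tsupport fun x hx => ?_
  have hxU := hs (tsupport_mul_subset_right hx)
  exact (hf.continuousAt (hU.mem_nhds hxU)).mul hh.continuousAt

variable [BorelSpace E] {μ : Measure E}
  {f : ι → E → ℝ} {e : ι → E} {g ψ φ : E → ℝ}

theorem integrable_divPairing [IsFiniteMeasureOnCompacts μ] (hf : ∀ i, LocallyIntegrable (f i) μ)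
    (hg : LocallyIntegrable g μ) (hψ : ContDiff ℝ 1 ψ) (hψc : HasCompactSupport ψ) :
    Integrable (fun x => (∑ i, f i x * fderiv ℝ ψ x (e i)) + g x * ψ x) μ := by
  refine (integrable_finsetSum _ fun i _ => ?_).add ?_
  · exact (hf i).integrable_smul_right_of_hasCompactSupport
      ((hψ.continuous_fderiv one_ne_zero).clm_apply continuous_const) (hψc.fderiv_apply ℝ (e i))
  · exact hg.integrable_smul_right_of_hasCompactSupport hψ.continuous hψc

theorem divPairing_add [IsFiniteMeasureOnCompacts μ] (hf : ∀ i, LocallyIntegrable (f i) μ)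
    (hg : LocallyIntegrable g μ) (hψ : ContDiff ℝ 1 ψ) (hψc : HasCompactSupport ψ)
    (hφ : ContDiff ℝ 1 φ) (hφc : HasCompactSupport φ) :
    divPairing μ f e g (fun x => ψ x + φ x) = divPairing μ f e g ψ + divPairing μ f e g φ := by
  unfold divPairing
  rw [← integral_add (integrable_divPairing hf hg hψ hψc) (integrable_divPairing hf hg hφ hφc)]
  congr 1
  ext x
  rw [fderiv_fun_add (hψ.differentiable one_ne_zero x) (hφ.differentiable one_ne_zero x)]
  simp only [add_apply, mul_add, Finset.sum_add_distrib]
  ring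

/-- Integration by parts where the fields are continuously differentiable. -/
theorem divPairing_eq_zero_of_contDiffOn [FiniteDimensional ℝ E] [μ.IsAddHaarMeasure]
    {U : Set E} (hU : IsOpen U)
    (hf : ∀ i, ContDiffOn ℝ 1 (f i) U) (hg : ∀ x ∈ U, g x = ∑ i, fderiv ℝ (f i) x (e i))
    (hψ : ContDiff ℝ 1 ψ) (hψc : HasCompactSupport ψ) (hs : tsupport ψ ⊆ U) :
    divPairing μ f e g ψ = 0 := by
  have hψ' : ∀ i, Continuous fun x => fderiv ℝ ψ x (e i) := fun i =>
    (hψ.continuous_fderiv one_ne_zero).clm_apply continuous_const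
  have h1 : ∀ i, Integrable (fun x => f i x * fderiv ℝ ψ x (e i)) μ := fun i =>
    (continuous_mul_of_tsupport_subset hU (hf i).continuousOn (hψ' i)
      ((tsupport_fderiv_apply_subset ℝ (e i)).trans hs)).integrable_of_hasCompactSupport
      (hψc.fderiv_apply ℝ (e i)).mul_left
  have h2 : ∀ i, Integrable (fun x => fderiv ℝ (f i) x (e i) * ψ x) μ := fun i =>
    (continuous_mul_of_tsupport_subset hU
      (((hf i).continuousOn_fderiv_of_isOpen hU le_rfl).clm_apply continuousOn_const)
      hψ.continuous hs).integrable_of_hasCompactSupport hψc.mul_left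
  have h3 : ∀ i, Integrable (fun x => f i x * ψ x) μ := fun i =>
    (continuous_mul_of_tsupport_subset hU (hf i).continuousOn
      hψ.continuous hs).integrable_of_hasCompactSupport hψc.mul_left
  have hgψ : (fun x => g x * ψ x) = fun x => ∑ i, fderiv ℝ (f i) x (e i) * ψ x := by
    ext x
    by_cases hx : x ∈ tsupport ψ
    · rw [hg x (hs hx), Finset.sum_mul]
    · simp [image_eq_zero_of_notMem_tsupport hx]
  have hgi : Integrable (fun x => g x * ψ x) μ := by
    rw [hgψ]
    exact integrable_finsetSum _ fun i _ => h2 i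
  unfold divPairing
  rw [integral_add (integrable_finsetSum _ fun i _ => h1 i) hgi, hgψ,
    integral_finsetSum _ fun i _ => h1 i, integral_finsetSum _ fun i _ => h2 i,
    ← Finset.sum_add_distrib]
  refine Finset.sum_eq_zero fun i _ => ?_
  rw [integral_mul_fderiv_eq_neg_fderiv_mul_of_integrable (h2 i) (h1 i) (h3 i)
    (fun x hx => ((hf i).contDiffAt (hU.mem_nhds (hs hx))).differentiableAt one_ne_zero)
    (fun x _ => hψ.differentiable one_ne_zero x), neg_add_cancel]

end DivPairing

/-! ### Localization by partitions of unity -/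

section Locality

open scoped Manifold

variable {E : Type*} [NormedAddCommGroup E] [NormedSpace ℝ E] [FiniteDimensional ℝ E]

/-- An additive property of compactly supported `C¹` functions that holds locally on `O` holds for
all such functions supported in `O`. -/
theorem contDiff_compactSupport_induction {P : (E → ℝ) → Prop} {O : Set E}
    (h0 : P fun _ => 0)
    (hadd : ∀ ψ φ : E → ℝ, ContDiff ℝ 1 ψ → HasCompactSupport ψ → ContDiff ℝ 1 φ →
      HasCompactSupport φ → P ψ → P φ → P fun x => ψ x + φ x)
    (hloc : ∀ p ∈ O, ∃ U ∈ 𝓝 p, ∀ ψ : E → ℝ, ContDiff ℝ 1 ψ → HasCompactSupport ψ →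
      tsupport ψ ⊆ U → P ψ)
    {ψ : E → ℝ} (hψ : ContDiff ℝ 1 ψ) (hψc : HasCompactSupport ψ) (hs : tsupport ψ ⊆ O) :
    P ψ := by
  choose! U hU hP using hloc
  obtain ⟨ρ, hρ⟩ := SmoothPartitionOfUnity.exists_isSubordinate 𝓘(ℝ, E)
    (isClosed_tsupport ψ) (fun p : tsupport ψ => interior (U p)) (fun _ => isOpen_interior)
    (fun p hp => Set.mem_iUnion.2 ⟨⟨p, hp⟩, mem_interior_iff_mem_nhds.2 (hU p (hs hp))⟩)
  -- Only finitely many members of the partition meet the compact support, so additivity for two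
  -- functions is enough.
  have hfin := ρ.locallyFinite.finite_nonempty_inter_compact hψc
  have hsum : ψ = fun x => ∑ i ∈ hfin.toFinset, ρ i x * ψ x := by
    ext x
    rw [← Finset.sum_mul]
    by_cases hx : x ∈ tsupport ψ
    · have h1 := ρ.sum_eq_one hx
      rw [finsum_eq_sum_of_support_subset (s := hfin.toFinset)] at h1
      · rw [h1, one_mul]
      · intro i hi
        simp only [Set.Finite.coe_toFinset, Set.mem_ofPred_eq]
        exact ⟨x, hi, hx⟩
    · simp [image_eq_zero_of_notMem_tsupport hx]
  have hterm : ∀ i, ContDiff ℝ 1 (fun x => ρ i x * ψ x) := fun i =>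
    ((contMDiff_iff_contDiff.1 (ρ i).contMDiff).of_le (by exact_mod_cast le_top)).mul hψ
  have key : ∀ s : Finset (tsupport ψ), P (fun x => ∑ i ∈ s, ρ i x * ψ x) ∧
      ContDiff ℝ 1 (fun x => ∑ i ∈ s, ρ i x * ψ x) ∧
      HasCompactSupport (fun x => ∑ i ∈ s, ρ i x * ψ x) := by
    classical
    intro s
    induction s using Finset.induction_on with
    | empty => simpa using ⟨h0, contDiff_const, HasCompactSupport.zero⟩
    | insert i s hi ih =>
      simp only [Finset.sum_insert hi]
      refine ⟨hadd _ _ (hterm i) hψc.mul_left ih.2.1 ih.2.2 ?_ ih.1, (hterm i).add ih.2.1,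
        hψc.mul_left.add ih.2.2⟩
      refine hP i (hs i.2) _ (hterm i) hψc.mul_left ?_
      exact (tsupport_mul_subset_left.trans (hρ i)).trans interior_subset
  rw [hsum]
  exact (key _).1

end Locality

/-! ### Removability of sets of codimension greater than one -/

section Cutoff

open Measure Metric

/-- A compact set of zero `d`-dimensional Hausdorff measure has finite coverings by balls with
arbitrarily small sum of the `d`-th powers of the radii. -/
theorem exists_finset_ball_cover {E : Type*} [MetricSpace E] [Nonempty E] [MeasurableSpace E]
    [BorelSpace E]
    {d : ℕ} {K : Set E} (hK : IsCompact K) (h0 : μH[(d : ℝ)] K = 0) {ε : ℝ} (hε : 0 < ε) :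
    ∃ (s : Finset ℕ) (x : ℕ → E) (r : ℕ → ℝ), (∀ n ∈ s, 0 < r n ∧ r n ≤ 1) ∧
      K ⊆ ⋃ n ∈ s, ball (x n) (r n) ∧ ∑ n ∈ s, r n ^ d ≤ ε := by
  classical
  have hε2 := ENNReal.ofReal_pos.2 (half_pos hε)
  rw [hausdorffMeasure_apply, ENNReal.iSup_eq_zero] at h0
  -- A single scale is enough; diameters at most `1/2` leave room to enlarge the radii and still
  -- keep them below `1`.
  have h1 := h0 (1 / 2)
  rw [ENNReal.iSup_eq_zero] at h1
  have h2 := (h1 (by norm_num)).trans_lt hε2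
  simp only [iInf_lt_iff] at h2
  obtain ⟨t, hcov, hdiam, hsum⟩ := h2
  -- Open balls must have radii strictly above the diameters; `δ n` is a summable allowance for this
  -- excess.
  obtain ⟨δ, hδ, hδsum⟩ := ENNReal.exists_pos_sum_of_countable' hε2.ne' ℕ
  have hx : ∀ n, ∃ x : E, (t n).Nonempty → x ∈ t n := fun n => by
    by_cases h : (t n).Nonempty
    · exact ⟨h.choose, fun _ => h.choose_spec⟩
    · exact ⟨Classical.arbitrary E, fun h' => absurd h' h⟩
  choose x hx using hx
  have hfin : ∀ n, ediam (t n) ≠ ⊤ := fun n => ((hdiam n).trans_lt (by simp)).ne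
  have hr : ∀ n, ∃ r : ℝ, diam (t n) < r ∧ r ≤ 1 ∧
      ENNReal.ofReal r ^ d ≤ ediam (t n) ^ d + δ n := fun n => by
    have hc : ContinuousAt (fun r : ℝ => ENNReal.ofReal r ^ d) (diam (t n)) :=
      ((ENNReal.continuous_pow d).comp ENNReal.continuous_ofReal).continuousAt
    have hv : ENNReal.ofReal (diam (t n)) = ediam (t n) := ENNReal.ofReal_toReal (hfin n)
    have hlt : ENNReal.ofReal (diam (t n)) ^ d < ediam (t n) ^ d + δ n := by
      rw [hv]
      exact ENNReal.lt_add_right (ENNReal.pow_ne_top (hfin n)) (hδ n).ne'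
    have hd1 : diam (t n) < 1 := by
      refine (ENNReal.toReal_mono (by simp) (hdiam n)).trans_lt ?_
      norm_num
    obtain ⟨r, hr, hr'⟩ := (((hc.eventually (gt_mem_nhds hlt)).filter_mono
      nhdsWithin_le_nhds).and (Ioc_mem_nhdsGT hd1)).exists
    exact ⟨r, hr'.1, hr'.2, hr.le⟩
  choose r hrd hr1 hrp using hr
  have hr0 : ∀ n, 0 < r n := fun n => diam_nonneg.trans_lt (hrd n)
  -- The subcover uses nonempty pieces only, since the Hausdorff sum counts an empty piece as zero
  -- even for `d = 0`.
  obtain ⟨b, hb, hbf, hbc⟩ := hK.elim_finite_subcover_image (b := {n | (t n).Nonempty})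
    (c := fun n => ball (x n) (r n)) (fun _ _ => isOpen_ball) (fun y hy => by
      obtain ⟨n, hn⟩ := Set.mem_iUnion.1 (hcov hy)
      refine Set.mem_biUnion (x := n) ⟨y, hn⟩ ?_
      exact (dist_le_diam_of_mem' (hfin n) hn (hx n ⟨y, hn⟩)).trans_lt (hrd n))
  refine ⟨hbf.toFinset, x, r, fun n _ => ⟨hr0 n, hr1 n⟩, by simpa using hbc, ?_⟩
  rw [← ENNReal.ofReal_le_ofReal_iff hε.le,
    ENNReal.ofReal_sum_of_nonneg fun n _ => (pow_pos (hr0 n) d).le]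
  calc ∑ n ∈ hbf.toFinset, ENNReal.ofReal (r n ^ d)
      ≤ ∑ n ∈ hbf.toFinset, ((⨆ _ : (t n).Nonempty, ediam (t n) ^ (d : ℝ)) + δ n) := by
        refine Finset.sum_le_sum fun n hn => ?_
        have hne : (t n).Nonempty := hb (hbf.mem_toFinset.1 hn)
        rw [ENNReal.ofReal_pow (hr0 n).le, ciSup_pos hne, ENNReal.rpow_natCast]
        exact hrp n
    _ ≤ (∑' n, ⨆ _ : (t n).Nonempty, ediam (t n) ^ (d : ℝ)) + ∑' n, δ n := by
        rw [Finset.sum_add_distrib]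
        exact add_le_add (ENNReal.sum_le_tsum _) (ENNReal.sum_le_tsum _)
    _ ≤ ENNReal.ofReal (ε / 2) + ENNReal.ofReal (ε / 2) := add_le_add hsum.le hδsum.le
    _ = ENNReal.ofReal ε := by
        rw [← ENNReal.ofReal_add (by positivity) (by positivity), add_halves]

variable {E : Type*} [NormedAddCommGroup E] [NormedSpace ℝ E]

/-- In the product rule the remaining factors lie in `[0, 1]` and can be dropped, so overlaps of the
balls cost nothing in the gradient of a product of cutoffs. -/
theorem norm_fderiv_prod_le {ι : Type*} (s : Finset ι) {a : ι → E → ℝ}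
    (ha : ∀ i, Differentiable ℝ (a i)) (h01 : ∀ i x, a i x ∈ Set.Icc (0 : ℝ) 1) (x : E) :
    ‖fderiv ℝ (fun y => ∏ i ∈ s, a i y) x‖ ≤ ∑ i ∈ s, ‖fderiv ℝ (a i) x‖ := by
  classical
  rw [fderiv_finsetProd fun i _ => ha i x]
  refine (norm_sum_le _ _).trans (Finset.sum_le_sum fun i _ => ?_)
  rw [norm_smul]
  refine mul_le_of_le_one_left (norm_nonneg _) ?_
  rw [Real.norm_of_nonneg (Finset.prod_nonneg fun j _ => (h01 j x).1)]
  exact Finset.prod_le_one (fun j _ => (h01 j x).1) fun j _ => (h01 j x).2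

variable [FiniteDimensional ℝ E]

/-- Smooth bump functions with the natural bound of their derivatives. -/
theorem exists_scaled_bump : ∃ C : ℝ, 0 < C ∧ ∀ (x : E) (r : ℝ), 0 < r → ∃ η : E → ℝ,
    ContDiff ℝ 1 η ∧ (∀ y, η y ∈ Set.Icc (0 : ℝ) 1) ∧ (∀ y ∈ ball x r, η y = 1) ∧
      (∀ y ∉ closedBall x (2 * r), η y = 0) ∧ (∀ y, ‖fderiv ℝ η y‖ ≤ C / r) ∧
      ∀ y ∉ closedBall x (2 * r), fderiv ℝ η y = 0 := by
  let b : ContDiffBump (0 : E) := ⟨1, 2, one_pos, one_lt_two⟩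
  have hb1 : ContDiff ℝ 1 b := b.contDiff
  have hbd : Continuous (fderiv ℝ b) := hb1.continuous_fderiv one_ne_zero
  obtain ⟨C, hC⟩ := hbd.bounded_above_of_compact_support (b.hasCompactSupport.fderiv ℝ)
  have hzero : ∀ y : E, 2 < ‖y‖ → b y = 0 := fun y hy => b.zero_of_le_dist (by simpa using hy.le)
  have hfar : ∀ (x : E) (r : ℝ), 0 < r → ∀ y ∉ closedBall x (2 * r), b (r⁻¹ • (y - x)) = 0 := by
    intro x r hr y hy
    refine hzero _ ?_
    rw [norm_smul, Real.norm_of_nonneg (by positivity), ← dist_eq_norm, lt_inv_mul_iff₀ hr, mul_comm]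
    simpa using hy
  refine ⟨max C 1, by positivity, fun x r hr => ⟨fun y => b (r⁻¹ • (y - x)), ?_, ?_, ?_, ?_, ?_, ?_⟩⟩
  · exact hb1.comp ((contDiff_id.sub contDiff_const).const_smul _)
  · exact fun y => ⟨b.nonneg, b.le_one⟩
  · intro y hy
    refine b.one_of_mem_closedBall ?_
    rw [mem_closedBall_zero_iff, norm_smul, Real.norm_of_nonneg (by positivity),
      inv_mul_le_iff₀ hr, ← dist_eq_norm]
    simpa [b] using (mem_ball.1 hy).le
  · exact hfar x r hr
  · intro y
    have hd : HasFDerivAt (fun y => b (r⁻¹ • (y - x))) ((fderiv ℝ b (r⁻¹ • (y - x))).comp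
        (r⁻¹ • ContinuousLinearMap.id ℝ E)) y :=
      ((hb1.differentiable one_ne_zero _).hasFDerivAt).comp y
        (((hasFDerivAt_id y).sub_const x).const_smul r⁻¹)
    rw [hd.fderiv, ContinuousLinearMap.comp_smul, ContinuousLinearMap.comp_id, norm_smul,
      Real.norm_of_nonneg (by positivity), div_eq_inv_mul]
    gcongr
    exact (hC _).trans (le_max_left _ _)
  · intro y hy
    have : (fun y => b (r⁻¹ • (y - x))) =ᶠ[𝓝 y] fun _ => 0 := by
      filter_upwards [isClosed_closedBall.isOpen_compl.mem_nhds hy] with z hz using hfar x r hr z hz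
    rw [this.fderiv_eq, fderiv_const_apply]

variable [MeasurableSpace E] [BorelSpace E] {μ : Measure E} [μ.IsAddHaarMeasure]

/-- A compact set of zero `d`-dimensional Hausdorff measure in a `d + 1`-dimensional space can be
cut off at the cost of a gradient that is small in the mean. -/
theorem exists_cutoff {d : ℕ} (hd : Module.finrank ℝ E = d + 1) {K : Set E} (hK : IsCompact K)
    (h0 : μH[(d : ℝ)] K = 0) {ε : ℝ} (hε : 0 < ε) :
    ∃ χ : E → ℝ, ContDiff ℝ 1 χ ∧ (∀ x, χ x ∈ Set.Icc (0 : ℝ) 1) ∧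
      (∃ U, IsOpen U ∧ K ⊆ U ∧ ∀ x ∈ U, χ x = 0) ∧
      (∃ S, MeasurableSet S ∧ μ S ≤ ENNReal.ofReal ε ∧ ∀ x ∉ S, χ x = 1) ∧
      Integrable (fun x => ‖fderiv ℝ χ x‖) μ ∧ ∫ x, ‖fderiv ℝ χ x‖ ∂μ ≤ ε := by
  obtain ⟨C, hC, hbump⟩ := exists_scaled_bump (E := E)
  set m : ℝ := μ.real (ball 0 1)
  have hm : 0 ≤ m := measureReal_nonneg
  -- A ball of radius `2r` has measure `2^(d+1) r^(d+1) m`, and there the gradient is at most `C /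
  -- r`. This `A` dominates the factor of `r^d` in both the measure and the gradient estimate.
  set A : ℝ := 2 ^ (d + 1) * (C + 1) * (m + 1)
  have hA : 0 < A := by positivity
  obtain ⟨s, x, r, hr, hcov, hsum⟩ := exists_finset_ball_cover hK h0 (div_pos hε hA)
  have hη : ∀ n, ∃ η : E → ℝ, ContDiff ℝ 1 η ∧ (∀ y, η y ∈ Set.Icc (0 : ℝ) 1) ∧ (n ∈ s →
      (∀ y ∈ ball (x n) (r n), η y = 1) ∧ (∀ y ∉ closedBall (x n) (2 * r n), η y = 0) ∧
      (∀ y, ‖fderiv ℝ η y‖ ≤ C / r n) ∧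
      ∀ y ∉ closedBall (x n) (2 * r n), fderiv ℝ η y = 0) := fun n => by
    by_cases hn : n ∈ s
    · obtain ⟨η, h1, h2, h3⟩ := hbump (x n) (r n) (hr n hn).1
      exact ⟨η, h1, h2, fun _ => h3⟩
    · exact ⟨fun _ => 0, contDiff_const, by simp, fun h => absurd h hn⟩
  choose η hη1 hη01 hη using hη
  have hvol : ∀ n ∈ s, μ.real (closedBall (x n) (2 * r n)) = 2 ^ (d + 1) * r n ^ (d + 1) * m :=
    fun n hn => by
      rw [addHaar_real_closedBall μ _ (by linarith [(hr n hn).1]), hd, mul_pow]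
  have hD : ∀ y, ‖fderiv ℝ (fun y => ∏ n ∈ s, (1 - η n y)) y‖ ≤
      ∑ n ∈ s, (closedBall (x n) (2 * r n)).indicator (fun _ => C / r n) y := fun y => by
    refine (norm_fderiv_prod_le s (a := fun n y => 1 - η n y)
      (fun n => (differentiable_const _).sub ((hη1 n).differentiable one_ne_zero))
      (fun n y => ⟨by linarith [(hη01 n y).2], by linarith [(hη01 n y).1]⟩) y).trans
      (Finset.sum_le_sum fun n hn => ?_)
    rw [fderiv_const_sub, norm_neg]
    by_cases hy : y ∈ closedBall (x n) (2 * r n)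
    · rw [Set.indicator_of_mem hy]
      exact (hη n hn).2.2.1 y
    · rw [Set.indicator_of_notMem hy, (hη n hn).2.2.2 y hy, norm_zero]
  have hind : ∀ n, Integrable ((closedBall (x n) (2 * r n)).indicator fun _ => C / r n) μ :=
    fun n => (integrable_indicator_iff measurableSet_closedBall).2
      (integrableOn_const (isCompact_closedBall _ _).measure_lt_top.ne)
  have hB : Integrable (fun y => ∑ n ∈ s,
      (closedBall (x n) (2 * r n)).indicator (fun _ => C / r n) y) μ :=
    integrable_finsetSum _ fun n _ => hind n
  have hχ : ContDiff ℝ 1 fun y => ∏ n ∈ s, (1 - η n y) :=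
    contDiff_prod fun n _ => contDiff_const.sub (hη1 n)
  have hDi : Integrable (fun y => ‖fderiv ℝ (fun y => ∏ n ∈ s, (1 - η n y)) y‖) μ :=
    hB.mono' (hχ.continuous_fderiv one_ne_zero).norm.aestronglyMeasurable
      (Eventually.of_forall fun y => by simpa using hD y)
  refine ⟨fun y => ∏ n ∈ s, (1 - η n y), hχ, fun y => ⟨?_, ?_⟩,
    ⟨⋃ n ∈ s, ball (x n) (r n), isOpen_biUnion fun _ _ => isOpen_ball, hcov, ?_⟩,
    ⟨⋃ n ∈ s, closedBall (x n) (2 * r n),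
      s.measurableSet_biUnion fun _ _ => measurableSet_closedBall, ?_, ?_⟩, hDi, ?_⟩
  · exact Finset.prod_nonneg fun n _ => by linarith [(hη01 n y).2]
  · exact Finset.prod_le_one (fun n _ => by linarith [(hη01 n y).2])
      fun n _ => by linarith [(hη01 n y).1]
  · intro y hy
    obtain ⟨n, hn, hyn⟩ := Set.mem_iUnion₂.1 hy
    exact Finset.prod_eq_zero hn (by rw [(hη n hn).1 y hyn, sub_self])
  · refine (measure_biUnion_finset_le s _).trans ?_
    have : ∑ n ∈ s, μ (closedBall (x n) (2 * r n)) =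
        ENNReal.ofReal (∑ n ∈ s, μ.real (closedBall (x n) (2 * r n))) := by
      rw [ENNReal.ofReal_sum_of_nonneg fun _ _ => measureReal_nonneg]
      refine Finset.sum_congr rfl fun n _ => ?_
      rw [ofReal_measureReal (isCompact_closedBall _ _).measure_lt_top.ne]
    rw [this]
    refine ENNReal.ofReal_le_ofReal ?_
    calc ∑ n ∈ s, μ.real (closedBall (x n) (2 * r n)) ≤ ∑ n ∈ s, A * r n ^ d := by
          refine Finset.sum_le_sum fun n hn => ?_
          have h0 := (hr n hn).1
          rw [hvol n hn]
          -- The radii were kept at most `1` for this comparison.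
          have h1 : r n ^ (d + 1) ≤ r n ^ d := pow_le_pow_of_le_one h0.le (hr n hn).2 (by omega)
          have h2 : 0 ≤ r n ^ d := by positivity
          calc 2 ^ (d + 1) * r n ^ (d + 1) * m ≤ 2 ^ (d + 1) * r n ^ d * (m + 1) := by
                gcongr
                linarith
            _ = 2 ^ (d + 1) * 1 * (m + 1) * r n ^ d := by ring
            _ ≤ A * r n ^ d := by
                simp only [A]
                gcongr
                linarith
      _ ≤ ε := by
          rw [← Finset.mul_sum, mul_comm]
          exact (le_div_iff₀ hA).1 hsum
  · intro y hy
    refine Finset.prod_eq_one fun n hn => ?_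
    rw [(hη n hn).2.1 y fun h => hy (Set.mem_biUnion hn h), sub_zero]
  · calc ∫ y, ‖fderiv ℝ (fun y => ∏ n ∈ s, (1 - η n y)) y‖ ∂μ
        ≤ ∫ y, ∑ n ∈ s, (closedBall (x n) (2 * r n)).indicator (fun _ => C / r n) y ∂μ :=
          integral_mono hDi hB hD
      _ = ∑ n ∈ s, μ.real (closedBall (x n) (2 * r n)) * (C / r n) := by
          rw [integral_finsetSum _ fun n _ => hind n]
          refine Finset.sum_congr rfl fun n _ => ?_
          rw [integral_indicator_const _ measurableSet_closedBall, smul_eq_mul]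
      _ ≤ ∑ n ∈ s, A * r n ^ d := by
          refine Finset.sum_le_sum fun n hn => ?_
          have h0 := (hr n hn).1
          have h2 : 0 ≤ r n ^ d := by positivity
          rw [hvol n hn]
          calc 2 ^ (d + 1) * r n ^ (d + 1) * m * (C / r n) = 2 ^ (d + 1) * C * m * r n ^ d := by
                field_simp
                ring
            _ ≤ A * r n ^ d := by
                simp only [A]
                gcongr <;> linarith
      _ ≤ ε := by
          rw [← Finset.mul_sum, mul_comm]
          exact (le_div_iff₀ hA).1 hsum

/-- A function that is locally bounded off a set is bounded on compact sets off this set. -/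
theorem exists_bound_of_locallyBounded {X ι : Type*} [TopologicalSpace X] {f : ι → X → ℝ}
    {Z K : Set X} (hf : ∀ p, ∃ M : ℝ, ∀ᶠ q in 𝓝 p, q ∉ Z → ∀ i, |f i q| ≤ M)
    (hK : IsCompact K) : ∃ M : ℝ, 0 ≤ M ∧ ∀ q ∈ K, q ∉ Z → ∀ i, |f i q| ≤ M := by
  refine hK.induction_on (p := fun K => ∃ M : ℝ, 0 ≤ M ∧ ∀ q ∈ K, q ∉ Z → ∀ i, |f i q| ≤ M)
    ⟨0, le_rfl, by simp⟩ ?_ ?_ ?_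
  · rintro s t hst ⟨M, h0, hM⟩
    exact ⟨M, h0, fun q hq => hM q (hst hq)⟩
  · rintro s t ⟨M, h0, hM⟩ ⟨M', -, hM'⟩
    refine ⟨max M M', h0.trans (le_max_left _ _), fun q hq hqS i => ?_⟩
    rcases hq with hq | hq
    · exact (hM q hq hqS i).trans (le_max_left _ _)
    · exact (hM' q hq hqS i).trans (le_max_right _ _)
  · intro p _
    obtain ⟨M, hM⟩ := hf p
    exact ⟨_, mem_nhdsWithin_of_mem_nhds hM, max M 0, le_max_right _ _,
      fun q hq hqS i => (hq hqS i).trans (le_max_left _ _)⟩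

variable {ι : Type*} [Fintype ι] {f : ι → E → ℝ} {e : ι → E} {g φ : E → ℝ}

/-- Closed sets of zero `d`-dimensional Hausdorff measure are removable for locally bounded fields
in `d + 1` dimensions with locally integrable divergence. -/
theorem divPairing_eq_zero_of_hausdorffMeasure_eq_zero {d : ℕ}
    (hd : Module.finrank ℝ E = d + 1) {Z B : Set E} (hS : μ Z = 0)
    (hf : ∀ i, LocallyIntegrable (f i) μ)
    (hfb : ∀ p, ∃ M : ℝ, ∀ᶠ q in 𝓝 p, q ∉ Z → ∀ i, |f i q| ≤ M)
    (hg : LocallyIntegrable g μ) (hB : IsClosed B) (hB0 : μH[(d : ℝ)] B = 0)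
    (H : ∀ ψ : E → ℝ, ContDiff ℝ 1 ψ → HasCompactSupport ψ → tsupport ψ ⊆ Bᶜ →
      divPairing μ f e g ψ = 0)
    (hφ : ContDiff ℝ 1 φ) (hφc : HasCompactSupport φ) : divPairing μ f e g φ = 0 := by
  obtain ⟨M, hM0, hM⟩ := exists_bound_of_locallyBounded hfb hφc
  obtain ⟨C, hC⟩ := hφ.continuous.bounded_above_of_compact_support hφc
  have hC0 : 0 ≤ C := (norm_nonneg _).trans (hC 0)
  set T : E → ℝ := fun x => (∑ i, f i x * fderiv ℝ φ x (e i)) + g x * φ x with hT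
  have hTi : Integrable T μ := integrable_divPairing hf hg hφ hφc
  -- `B` need not be compact, but the cutoff only has to vanish near the part of `B` that meets the
  -- support of `φ`.
  have hK : IsCompact (tsupport φ ∩ B) := hφc.inter_right hB
  have hK0 : μH[(d : ℝ)] (tsupport φ ∩ B) = 0 := measure_mono_null Set.inter_subset_right hB0
  have hcut := fun n : ℕ => exists_cutoff (μ := μ) hd hK hK0 (ε := 1 / ((n : ℝ) + 1)) (by positivity)
  choose χ hχ hχ01 hχ0 hχ1 hDi hD using hcut
  choose S hSm hSμ hS1 using hχ1
  set R : ℝ := C * (M * ∑ i, ‖e i‖) with hR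
  have hR0 : 0 ≤ R := by positivity
  -- Testing with `χ n * φ` gives zero by `H`. The product rule leaves `∫ χ T = -∫ Q`, where `Q`
  -- carries the gradient of the cutoff; the missing `(1 - χ) T` lives on `S n`.
  have hbound : ∀ n, |∫ x, T x ∂μ| ≤ (∫ x in S n, ‖T x‖ ∂μ) + R * (1 / ((n : ℝ) + 1)) := fun n => by
    obtain ⟨U, hU, hKU, hχU⟩ := hχ0 n
    have hψ : ContDiff ℝ 1 fun x => χ n x * φ x := (hχ n).mul hφ
    have hψc : HasCompactSupport fun x => χ n x * φ x := hφc.mul_left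
    have hsub : tsupport (fun x => χ n x * φ x) ⊆ Bᶜ := by
      intro x hx hxB
      have hxφ : x ∈ tsupport φ := tsupport_mul_subset_right hx
      have : tsupport (χ n) ⊆ Uᶜ := closure_minimal
        (fun y hy hyU => hy (hχU y hyU)) hU.isClosed_compl
      exact this (tsupport_mul_subset_left hx) (hKU ⟨hxφ, hxB⟩)
    set Q : E → ℝ := fun x => φ x * ∑ i, f i x * fderiv ℝ (χ n) x (e i) with hQ
    have hψT : ∀ x, (∑ i, f i x * fderiv ℝ (fun x => χ n x * φ x) x (e i)) +
        g x * (χ n x * φ x) = χ n x * T x + Q x := fun x => by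
      rw [fderiv_fun_mul ((hχ n).differentiable one_ne_zero x) (hφ.differentiable one_ne_zero x)]
      simp only [hT, hQ, _root_.add_apply, _root_.smul_apply, smul_eq_mul, mul_add, Finset.sum_add_distrib,
        Finset.mul_sum]
      have : ∀ i, f i x * (χ n x * fderiv ℝ φ x (e i)) = χ n x * (f i x * fderiv ℝ φ x (e i)) ∧
          f i x * (φ x * fderiv ℝ (χ n) x (e i)) = φ x * (f i x * fderiv ℝ (χ n) x (e i)) :=
        fun i => ⟨by ring, by ring⟩
      simp only [this]
      ring
    have hχT : Integrable (fun x => χ n x * T x) μ := by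
      refine hTi.bdd_mul (c := 1) (hχ n).continuous.aestronglyMeasurable
        (Eventually.of_forall fun x => ?_)
      rw [Real.norm_of_nonneg (hχ01 n x).1]
      exact (hχ01 n x).2
    have hQi : Integrable Q μ := by
      have h := (integrable_divPairing (e := e) hf hg hψ hψc).sub hχT
      refine h.congr (Eventually.of_forall fun x => ?_)
      simp only [Pi.sub_apply]
      rw [hψT x]
      ring
    have h0 := H _ hψ hψc hsub
    unfold divPairing at h0
    simp_rw [hψT] at h0
    rw [integral_add hχT hQi] at h0
    have h1 : ∫ x, T x ∂μ = ∫ x, (1 - χ n x) * T x ∂μ - ∫ x, Q x ∂μ := by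
      simp_rw [sub_mul, one_mul]
      rw [integral_sub hTi hχT]
      linarith
    have h2 : |∫ x, (1 - χ n x) * T x ∂μ| ≤ ∫ x in S n, ‖T x‖ ∂μ := by
      rw [← integral_indicator (hSm n), ← Real.norm_eq_abs]
      refine norm_integral_le_of_norm_le (hTi.norm.indicator (hSm n))
        (Eventually.of_forall fun x => ?_)
      by_cases hx : x ∈ S n
      · rw [Set.indicator_of_mem hx, norm_mul]
        refine mul_le_of_le_one_left (norm_nonneg _) ?_
        rw [Real.norm_of_nonneg (by linarith [(hχ01 n x).2])]
        linarith [(hχ01 n x).1]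
      · rw [hS1 n x hx, sub_self, zero_mul, norm_zero]
        exact Set.indicator_nonneg (fun _ _ => norm_nonneg _) x
    have h3 : |∫ x, Q x ∂μ| ≤ R * (1 / ((n : ℝ) + 1)) := by
      rw [← Real.norm_eq_abs]
      refine le_trans (norm_integral_le_of_norm_le ((hDi n).const_mul R) ?_) ?_
      · have hae : ∀ᵐ x ∂μ, x ∉ Z := measure_eq_zero_iff_ae_notMem.1 hS
        filter_upwards [hae] with x hx
        by_cases hxφ : x ∈ tsupport φ
        · rw [hQ, hR, norm_mul, mul_assoc C, mul_assoc M]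
          refine mul_le_mul (hC x) ?_ (norm_nonneg _) hC0
          refine (norm_sum_le _ _).trans ?_
          rw [Finset.sum_mul, Finset.mul_sum]
          refine Finset.sum_le_sum fun i _ => ?_
          rw [norm_mul]
          refine mul_le_mul (hM x hxφ hx i) ?_ (norm_nonneg _) hM0
          rw [mul_comm]
          exact ContinuousLinearMap.le_opNorm _ _
        · simp only [hQ, image_eq_zero_of_notMem_tsupport hxφ, zero_mul, norm_zero]
          positivity
      · rw [integral_const_mul]
        exact mul_le_mul_of_nonneg_left (hD n) hR0
    rw [h1]
    exact (abs_sub _ _).trans (add_le_add h2 h3)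
  -- `T` is only integrable, so its part over `S n` vanishes by absolute continuity of the integral.
  have hlim : Tendsto (fun n : ℕ => (∫ x in S n, ‖T x‖ ∂μ) + R * (1 / ((n : ℝ) + 1))) atTop
      (𝓝 (0 + R * 0)) := by
    refine Tendsto.add (hTi.norm.tendsto_setIntegral_nhds_zero ?_)
      (tendsto_one_div_add_atTop_nhds_zero_nat.const_mul R)
    refine tendsto_of_tendsto_of_tendsto_of_le_of_le tendsto_const_nhds ?_
      (fun _ => zero_le) hSμ
    simpa using ENNReal.tendsto_ofReal tendsto_one_div_add_atTop_nhds_zero_nat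
  have hle := ge_of_tendsto' hlim hbound
  rw [mul_zero, add_zero] at hle
  exact abs_nonpos_iff.1 hle

end Cutoff

/-! ### Passing to the limit across a graph -/

section Graph

/-- A `C¹` bump function on the line, equal to `1` on `[-1, 1]`. -/
theorem exists_bump_real : ∃ b : ℝ → ℝ, ContDiff ℝ 1 b ∧ (∀ s, b s ∈ Set.Icc (0 : ℝ) 1) ∧
    (∀ s, |s| ≤ 1 → b s = 1) ∧ (∀ s, 2 ≤ |s| → b s = 0) ∧ HasCompactSupport (deriv b) ∧
      (∀ s, |s| < 1 → deriv b s = 0) ∧ ∫ s, deriv b s = 0 := by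
  let b : ContDiffBump (0 : ℝ) := ⟨1, 2, one_pos, one_lt_two⟩
  have hb : ContDiff ℝ 1 b := b.contDiff
  have hone : ∀ s : ℝ, |s| ≤ 1 → b s = 1 := fun s hs =>
    b.one_of_mem_closedBall (by simpa [b] using hs)
  refine ⟨b, hb, fun s => ⟨b.nonneg, b.le_one⟩, hone,
    fun s hs => b.zero_of_le_dist (by simpa using hs), b.hasCompactSupport.deriv, ?_, ?_⟩
  · intro s hs
    have : (b : ℝ → ℝ) =ᶠ[𝓝 s] fun _ => 1 := by
      filter_upwards [(isOpen_lt continuous_abs continuous_const).mem_nhds hs] with y hy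
      exact hone y (le_of_lt hy)
    rw [this.deriv_eq, deriv_const]
  · have h0 := b.hasCompactSupport.is_zero_at_infty
    have := integral_of_hasDerivAt_of_tendsto (f := b) (m := 0) (n := 0)
      (fun s => (hb.differentiable one_ne_zero s).hasDerivAt)
      ((hb.continuous_deriv le_rfl).integrable_of_hasCompactSupport b.hasCompactSupport.deriv)
      (h0.mono_left atBot_le_cocompact) (h0.mono_left atTop_le_cocompact)
    simpa using this

theorem measure_graph_eq_zero {X : Type*} [TopologicalSpace X] [MeasurableSpace X]
    [OpensMeasurableSpace X] {μ : Measure X} {τ : X → ℝ} (hτ : Continuous τ) :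
    (μ.prod volume) {q : X × ℝ | q.2 = τ q.1} = 0 := by
  have hm : MeasurableSet {q : X × ℝ | q.2 = τ q.1} :=
    (isClosed_eq continuous_snd (hτ.comp continuous_fst)).measurableSet
  rw [Measure.measure_prod_null hm]
  refine Eventually.of_forall fun x => ?_
  have : Prod.mk x ⁻¹' {q : X × ℝ | q.2 = τ q.1} = {τ x} := by
    ext t
    simp
  simp [this]

/-- Fubini and `t = τ x + s / n` stretch the thin layer about the graph to a fixed width, so that
the concentrating kernel becomes independent of `n`. -/
theorem integral_prod_rescale {X : Type*} [MeasurableSpace X] {μ : Measure X} [SFinite μ]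
    {τ : X → ℝ} {P : X × ℝ → ℝ} (hP : Integrable P (μ.prod volume))
    {n : ℝ} (hn : 0 < n) :
    ∫ q, P q ∂(μ.prod volume) = ∫ x, (∫ s, n⁻¹ * P (x, τ x + n⁻¹ * s)) ∂μ := by
  rw [integral_prod _ hP]
  congr 1
  ext x
  rw [integral_const_mul, Measure.integral_comp_mul_left (fun s => P (x, τ x + s)) n⁻¹,
    integral_add_left_eq_self (fun s => P (x, s)) (τ x), inv_inv, abs_of_pos hn, smul_eq_mul,
    inv_mul_cancel_left₀ hn.ne']

variable {X ι : Type*} [NormedAddCommGroup X] [NormedSpace ℝ X] [FiniteDimensional ℝ X]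
  [MeasurableSpace X] [BorelSpace X] [Fintype ι] {μ : Measure X} [μ.IsAddHaarMeasure]
  {f : ι → X × ℝ → ℝ} {e : ι → X × ℝ} {g ψ : X × ℝ → ℝ}

/-- Concentrating families of kernels with mean zero transversally to a graph do not contribute
in the limit, if the field has equal limits on both sides of the graph. -/
theorem tendsto_integral_kernel_graph {τ : X → ℝ} {w h : X × ℝ → ℝ} {k : ℝ → ℝ}
    {U : Set (X × ℝ)}
    (hτ : Continuous τ) (hU : IsOpen U) (hw : ContinuousOn w (U \ {q | q.2 = τ q.1})) {W : ℝ}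
    (hh : Continuous h) (hhc : HasCompactSupport h) (hhU : tsupport h ⊆ U)
    (hW : ∀ q ∈ tsupport h, q.2 ≠ τ q.1 → |w q| ≤ W)
    (hk : Continuous k) (hkc : HasCompactSupport k) (hk1 : ∀ s, |s| < 1 → k s = 0)
    (hk0 : ∫ s, k s = 0)
    (hlim : ∀ x, (x, τ x) ∈ U → ∃ a, Tendsto (fun t => w (x, t)) (𝓝[≠] τ x) (𝓝 a)) :
    (∀ n : ℝ, Integrable (fun q : X × ℝ => w q * (h q * (n * k (n * (q.2 - τ q.1)))))
      (μ.prod volume)) ∧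
    Tendsto (fun n : ℕ => ∫ q : X × ℝ, w q * (h q * (((n : ℝ) + 1) *
      k (((n : ℝ) + 1) * (q.2 - τ q.1)))) ∂(μ.prod volume)) atTop (𝓝 0) := by
  have hcl : IsClosed {q : X × ℝ | q.2 = τ q.1} :=
    isClosed_eq continuous_snd (hτ.comp continuous_fst)
  -- The kernel vanishes for `|n (t - τ x)| < 1`, an open neighbourhood of the graph, which removes
  -- the only discontinuities of `w` in `U`.
  have hP : ∀ n : ℝ, Continuous fun q : X × ℝ => w q * (h q * (n * k (n * (q.2 - τ q.1)))) := by
    intro n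
    refine continuous_mul_of_tsupport_subset (hU.sdiff hcl) hw (by fun_prop) ?_
    intro q hq
    refine ⟨hhU (tsupport_mul_subset_left hq), fun hqτ => ?_⟩
    have hopen : IsOpen {q : X × ℝ | |n * (q.2 - τ q.1)| < 1} :=
      isOpen_lt (by fun_prop) continuous_const
    have hsub : tsupport (fun q : X × ℝ => h q * (n * k (n * (q.2 - τ q.1)))) ⊆
        {q : X × ℝ | |n * (q.2 - τ q.1)| < 1}ᶜ := by
      refine closure_minimal (fun y hy hy1 => hy ?_) hopen.isClosed_compl
      simp only [hk1 _ hy1, mul_zero]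
    refine hsub hq ?_
    have : q.2 = τ q.1 := hqτ
    simp [this]
  have hPi : ∀ n : ℝ, Integrable (fun q : X × ℝ => w q * (h q * (n * k (n * (q.2 - τ q.1)))))
      (μ.prod volume) := fun n =>
    (hP n).integrable_of_hasCompactSupport (hhc.mul_right.mul_left)
  refine ⟨hPi, ?_⟩
  obtain ⟨C, hC⟩ := hh.bounded_above_of_compact_support hhc
  have hC0 : 0 ≤ C := (norm_nonneg _).trans (hC 0)
  have hki : Integrable k := hk.integrable_of_hasCompactSupport hkc
  set K : Set X := Prod.fst '' tsupport h with hKdef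
  have hK : IsCompact K := hhc.image continuous_fst
  have hpos : ∀ n : ℕ, (0 : ℝ) < (n : ℝ) + 1 := fun n => by positivity
  set F : ℕ → X → ℝ → ℝ := fun n x s => ((n : ℝ) + 1)⁻¹ *
    (w (x, τ x + ((n : ℝ) + 1)⁻¹ * s) * (h (x, τ x + ((n : ℝ) + 1)⁻¹ * s) * (((n : ℝ) + 1) *
      k (((n : ℝ) + 1) * (τ x + ((n : ℝ) + 1)⁻¹ * s - τ x))))) with hFdef
  have hF : ∀ n x s, F n x s = w (x, τ x + ((n : ℝ) + 1)⁻¹ * s) *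
      h (x, τ x + ((n : ℝ) + 1)⁻¹ * s) * k s := fun n x s => by
    have h1 : ((n : ℝ) + 1) * (τ x + ((n : ℝ) + 1)⁻¹ * s - τ x) = s := by
      rw [add_sub_cancel_left, mul_inv_cancel_left₀ (hpos n).ne']
    simp only [hFdef, h1]
    field_simp [(hpos n).ne']
  have hint : ∀ n : ℕ, ∫ q : X × ℝ, w q * (h q * (((n : ℝ) + 1) *
      k (((n : ℝ) + 1) * (q.2 - τ q.1)))) ∂(μ.prod volume) = ∫ x, (∫ s, F n x s) ∂μ := fun n =>
    integral_prod_rescale (hPi _) (hpos n)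
  have hFc : ∀ n x, Continuous (F n x) := fun n x =>
    continuous_const.mul ((hP ((n : ℝ) + 1)).comp (by fun_prop))
  have hFb : ∀ n x s, ‖F n x s‖ ≤ K.indicator (fun _ => |W| * C) x * ‖k s‖ := fun n x s => by
    rw [hF, norm_mul]
    rcases eq_or_ne s 0 with rfl | hs
    · simp [hk1 0 (by simp)]
    refine mul_le_mul_of_nonneg_right ?_ (norm_nonneg _)
    by_cases hq : (x, τ x + ((n : ℝ) + 1)⁻¹ * s) ∈ tsupport h
    · rw [Set.indicator_of_mem (show x ∈ K from ⟨_, hq, rfl⟩), norm_mul]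
      refine mul_le_mul ((hW _ hq ?_).trans (le_abs_self W)) (hC _) (norm_nonneg _) (abs_nonneg W)
      have := mul_ne_zero (inv_ne_zero (hpos n).ne') hs
      simpa using this
    · rw [image_eq_zero_of_notMem_tsupport hq, mul_zero, norm_zero]
      exact Set.indicator_nonneg (fun _ _ => by positivity) x
  simp_rw [hint]
  have hinner : ∀ x, Tendsto (fun n => ∫ s, F n x s) atTop (𝓝 0) := fun x => by
    have hseq : ∀ s : ℝ, Tendsto (fun n : ℕ => τ x + ((n : ℝ) + 1)⁻¹ * s) atTop (𝓝 (τ x)) := by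
      intro s
      have := (tendsto_one_div_add_atTop_nhds_zero_nat (𝕜 := ℝ)).mul_const s
      simpa using this.const_add (τ x)
    -- The factor of `k s` in the limit is the same for both signs of `s`, because `w` has a common
    -- limit on the two sides; then `∫ k = 0` kills the integral.
    have hc : ∃ c : ℝ, ∀ s, Tendsto (fun n => F n x s) atTop (𝓝 (c * k s)) := by
      by_cases hxU : (x, τ x) ∈ U
      · obtain ⟨a, ha⟩ := hlim x hxU
        refine ⟨a * h (x, τ x), fun s => ?_⟩
        simp_rw [hF]
        by_cases hs : s = 0
        · simp [hk1 s (by simp [hs])]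
        refine Tendsto.mul_const _ (Tendsto.mul ?_ ?_)
        · refine ha.comp (tendsto_nhdsWithin_iff.2 ⟨hseq s, Eventually.of_forall fun n => ?_⟩)
          have := mul_ne_zero (inv_ne_zero (hpos n).ne') hs
          simpa using this
        · exact (hh.tendsto _).comp (tendsto_const_nhds.prodMk_nhds (hseq s))
      · refine ⟨0, fun s => ?_⟩
        rw [zero_mul]
        have h1 : ∀ᶠ q in 𝓝 (x, τ x), h q = 0 := by
          filter_upwards [(isClosed_tsupport h).isOpen_compl.mem_nhds fun hx => hxU (hhU hx)]
            with q hq using image_eq_zero_of_notMem_tsupport hq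
        have h2 : ∀ᶠ n : ℕ in atTop, F n x s = 0 := by
          filter_upwards [((tendsto_const_nhds (x := x)).prodMk_nhds (hseq s)).eventually h1]
            with n hn
          rw [hF, hn, mul_zero, zero_mul]
        exact tendsto_const_nhds.congr' (h2.mono fun n hn => hn.symm)
    obtain ⟨c, hc⟩ := hc
    have := tendsto_integral_of_dominated_convergence (fun s => K.indicator (fun _ => |W| * C) x * ‖k s‖)
      (fun n => (hFc n x).aestronglyMeasurable) (hki.norm.const_mul _)
      (fun n => Eventually.of_forall (hFb n x)) (Eventually.of_forall hc)
    rwa [integral_const_mul, hk0, mul_zero] at this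
  have hbK : Integrable (K.indicator fun _ => |W| * C) μ :=
    (integrable_indicator_iff hK.measurableSet).2 (integrableOn_const hK.measure_lt_top.ne)
  have := tendsto_integral_of_dominated_convergence (μ := μ) (F := fun n x => ∫ s, F n x s)
    (f := fun _ => (0 : ℝ))
    (fun x => K.indicator (fun _ => |W| * C) x * ∫ s, ‖k s‖) (fun n => ?_) (hbK.mul_const _)
    (fun n => Eventually.of_forall fun x => ?_) (Eventually.of_forall hinner)
  · simpa using this
  · have hcont : Continuous fun p : X × ℝ => F n p.1 p.2 :=
      continuous_const.mul ((hP ((n : ℝ) + 1)).comp (by fun_prop))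
    exact hcont.stronglyMeasurable.integral_prod_right'.aestronglyMeasurable
  · rw [← integral_const_mul]
    exact norm_integral_le_of_norm_le (hki.norm.const_mul _) (Eventually.of_forall (hFb n x))

/-- A field with equal normal components on both sides of a graph satisfies the divergence equation
across this graph in the sense of generalized functions. -/
theorem divPairing_eq_zero_of_graph {τ : X → ℝ} {U : Set (X × ℝ)} (hτ : ContDiff ℝ 1 τ)
    (hU : IsOpen U) (hfl : ∀ i, LocallyIntegrable (f i) (μ.prod volume))
    (hgl : LocallyIntegrable g (μ.prod volume))
    (hf : ∀ i, ContDiffOn ℝ 1 (f i) (U \ {q | q.2 = τ q.1})) {M : ℝ}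
    (hM : ∀ q ∈ U, q.2 ≠ τ q.1 → ∀ i, |f i q| ≤ M)
    (hg : ∀ q ∈ U, q.2 ≠ τ q.1 → g q = ∑ i, fderiv ℝ (f i) q (e i))
    (hflux : ∀ q ∈ U, q.2 = τ q.1 → ∃ a, Tendsto
      (fun y => ∑ i, f i y * ((e i).2 - fderiv ℝ τ q.1 (e i).1)) (𝓝[{y | y.2 ≠ τ y.1}] q) (𝓝 a))
    (hψ : ContDiff ℝ 1 ψ) (hψc : HasCompactSupport ψ) (hψU : tsupport ψ ⊆ U) :
    divPairing (μ.prod volume) f e g ψ = 0 := by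
  obtain ⟨b, hb, hb01, hb1, hb2, hkc, hk1, hk0⟩ := exists_bump_real
  have hcl : IsClosed {q : X × ℝ | q.2 = τ q.1} :=
    isClosed_eq continuous_snd (hτ.continuous.comp continuous_fst)
  have hτ' : Continuous (fderiv ℝ τ) := hτ.continuous_fderiv one_ne_zero
  set T : X × ℝ → ℝ := fun q => (∑ i, f i q * fderiv ℝ ψ q (e i)) + g q * ψ q with hT
  have hTi : Integrable T (μ.prod volume) := integrable_divPairing hfl hgl hψ hψc
  set w : X × ℝ → ℝ := fun q => ∑ i, f i q * ((e i).2 - fderiv ℝ τ q.1 (e i).1) with hw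
  have hwc : ContinuousOn w (U \ {q | q.2 = τ q.1}) :=
    continuousOn_finsetSum _ fun i _ => (hf i).continuousOn.mul
      (by fun_prop : Continuous fun q : X × ℝ => (e i).2 - fderiv ℝ τ q.1 (e i).1).continuousOn
  obtain ⟨W, hW⟩ : ∃ W, ∀ q ∈ tsupport ψ, q.2 ≠ τ q.1 → |w q| ≤ W := by
    have hc : Continuous fun q : X × ℝ => ∑ i, |M| * |(e i).2 - fderiv ℝ τ q.1 (e i).1| := by
      fun_prop
    obtain ⟨W, hW⟩ := (IsCompact.image hψc hc).bddAbove
    refine ⟨W, fun q hq hqτ => le_trans ?_ (hW ⟨q, hq, rfl⟩)⟩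
    refine (Finset.abs_sum_le_sum_abs _ _).trans (Finset.sum_le_sum fun i _ => ?_)
    rw [abs_mul]
    exact mul_le_mul_of_nonneg_right ((hM q (hψU hq) hqτ i).trans (le_abs_self M)) (abs_nonneg _)
  obtain ⟨hQi, hQ0⟩ := tendsto_integral_kernel_graph (μ := μ) hτ.continuous hU hwc hψ.continuous hψc
    hψU hW (hb.continuous_deriv le_rfl) hkc hk1 hk0 fun x hx => by
      obtain ⟨a, ha⟩ := hflux (x, τ x) hx rfl
      refine ⟨a, (ha.comp (f := fun t => (x, t)) ?_).congr fun t => rfl⟩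
      refine tendsto_nhdsWithin_iff.2
        ⟨(Continuous.prodMk_right x).continuousAt.tendsto.mono_left nhdsWithin_le_nhds, ?_⟩
      filter_upwards [self_mem_nhdsWithin] with t ht using ht
  -- The cutoff `η` vanishes near the graph, so the smooth case applies to `η ψ`. The derivative of
  -- `η` is the kernel times the conormal `(-τ', 1)`, which leaves exactly the flux `w`.
  have hstep : ∀ n : ℕ, ∫ q : X × ℝ, (1 - b (((n : ℝ) + 1) * (q.2 - τ q.1))) * T q
      ∂(μ.prod volume) = ∫ q : X × ℝ, w q * (ψ q * (((n : ℝ) + 1) *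
        deriv b (((n : ℝ) + 1) * (q.2 - τ q.1)))) ∂(μ.prod volume) := by
    intro n
    set η : X × ℝ → ℝ := fun q => 1 - b (((n : ℝ) + 1) * (q.2 - τ q.1)) with hη
    have hηc : ContDiff ℝ 1 η := by fun_prop
    have hηd : ∀ q v, fderiv ℝ η q v = -((((n : ℝ) + 1) *
        deriv b (((n : ℝ) + 1) * (q.2 - τ q.1))) * (v.2 - fderiv ℝ τ q.1 v.1)) := by
      intro q v
      have h1 : HasFDerivAt (fun q : X × ℝ => ((n : ℝ) + 1) * (q.2 - τ q.1))
          (((n : ℝ) + 1) • (ContinuousLinearMap.snd ℝ X ℝ -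
            (fderiv ℝ τ q.1).comp (ContinuousLinearMap.fst ℝ X ℝ))) q :=
        (hasFDerivAt_snd.sub (((hτ.differentiable one_ne_zero q.1).hasFDerivAt).comp q
          hasFDerivAt_fst)).const_mul _
      have h2 := ((hb.differentiable one_ne_zero _).hasDerivAt.comp_hasFDerivAt q h1).const_sub 1
      have h3 : fderiv ℝ η q = _ := h2.fderiv
      rw [h3]
      simp
      ring
    have hηψ : ContDiff ℝ 1 fun q => η q * ψ q := hηc.mul hψ
    have hηψc : HasCompactSupport fun q => η q * ψ q := hψc.mul_left
    have hsub : tsupport (fun q => η q * ψ q) ⊆ U \ {q | q.2 = τ q.1} := by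
      refine fun q hq => ⟨hψU (tsupport_mul_subset_right hq), fun hqτ => ?_⟩
      have hopen : IsOpen {q : X × ℝ | |((n : ℝ) + 1) * (q.2 - τ q.1)| < 1} :=
        isOpen_lt (continuous_const.mul
          (continuous_snd.sub (hτ.continuous.comp continuous_fst))).abs continuous_const
      have h1 : tsupport η ⊆ {q : X × ℝ | |((n : ℝ) + 1) * (q.2 - τ q.1)| < 1}ᶜ := by
        refine closure_minimal (fun y hy hy1 => hy ?_) hopen.isClosed_compl
        rw [hη]
        simp only [hb1 _ (le_of_lt hy1), sub_self]
      refine h1 (tsupport_mul_subset_left hq) ?_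
      have : q.2 = τ q.1 := hqτ
      simp [this]
    have h0 := divPairing_eq_zero_of_contDiffOn (μ := μ.prod volume) (hU.sdiff hcl) hf
      (fun q hq => hg q hq.1 hq.2) hηψ hηψc hsub
    have hexp : ∀ q, (∑ i, f i q * fderiv ℝ (fun q => η q * ψ q) q (e i)) + g q * (η q * ψ q) =
        η q * T q - w q * (ψ q * (((n : ℝ) + 1) * deriv b (((n : ℝ) + 1) * (q.2 - τ q.1)))) := by
      intro q
      rw [fderiv_fun_mul (hηc.differentiable one_ne_zero q) (hψ.differentiable one_ne_zero q)]
      simp only [add_apply, smul_apply, smul_eq_mul, hηd, hT, hw, Finset.sum_mul, mul_add,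
        Finset.sum_add_distrib, Finset.mul_sum]
      rw [add_right_comm, sub_eq_add_neg (_ + _)]
      congr 1
      · congr 1
        · exact Finset.sum_congr rfl fun i _ => by ring
        · ring
      · rw [← Finset.sum_neg_distrib]
        exact Finset.sum_congr rfl fun i _ => by ring
    have hηT : Integrable (fun q => η q * T q) (μ.prod volume) := by
      refine hTi.bdd_mul (c := 1) hηc.continuous.aestronglyMeasurable
        (Eventually.of_forall fun q => ?_)
      rw [Real.norm_of_nonneg (by linarith [(hb01 (((n : ℝ) + 1) * (q.2 - τ q.1))).2])]
      linarith [(hb01 (((n : ℝ) + 1) * (q.2 - τ q.1))).1]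
    unfold divPairing at h0
    simp_rw [hexp] at h0
    rw [integral_sub hηT (hQi _)] at h0
    linarith
  -- The cutoffs tend to `1` off the graph, a null set, and `‖T‖` dominates.
  have hlim : Tendsto (fun n : ℕ => ∫ q : X × ℝ, (1 - b (((n : ℝ) + 1) * (q.2 - τ q.1))) * T q
      ∂(μ.prod volume)) atTop (𝓝 (∫ q, T q ∂(μ.prod volume))) := by
    refine tendsto_integral_of_dominated_convergence (fun q => ‖T q‖) (fun n => ?_) hTi.norm
      (fun n => Eventually.of_forall fun q => ?_) ?_
    · exact (by fun_prop : Continuous fun q : X × ℝ =>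
        1 - b (((n : ℝ) + 1) * (q.2 - τ q.1))).aestronglyMeasurable.mul hTi.aestronglyMeasurable
    · rw [norm_mul]
      refine mul_le_of_le_one_left (norm_nonneg _) ?_
      rw [Real.norm_of_nonneg (by linarith [(hb01 (((n : ℝ) + 1) * (q.2 - τ q.1))).2])]
      linarith [(hb01 (((n : ℝ) + 1) * (q.2 - τ q.1))).1]
    · filter_upwards [measure_eq_zero_iff_ae_notMem.1 (measure_graph_eq_zero (μ := μ) hτ.continuous)]
        with q hq
      have hne : q.2 - τ q.1 ≠ 0 := sub_ne_zero.2 hq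
      have hev : ∀ᶠ n : ℕ in atTop, (1 - b (((n : ℝ) + 1) * (q.2 - τ q.1))) * T q = T q := by
        obtain ⟨n₀, hn₀⟩ := exists_nat_ge (2 / |q.2 - τ q.1|)
        filter_upwards [eventually_ge_atTop n₀] with n hn
        rw [hb2 _ ?_, sub_zero, one_mul]
        rw [abs_mul, abs_of_pos (by positivity : (0 : ℝ) < (n : ℝ) + 1)]
        rw [div_le_iff₀ (abs_pos.2 hne)] at hn₀
        refine hn₀.trans (mul_le_mul_of_nonneg_right ?_ (abs_nonneg _))
        have : (n₀ : ℝ) ≤ n := by exact_mod_cast hn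
        linarith
      exact tendsto_const_nhds.congr' (hev.mono fun n hn => hn.symm)
  simp_rw [hstep] at hlim
  exact tendsto_nhds_unique hlim hQ0

end Graph

/-! ### Level sets as graphs over space -/

section ImplicitGraph

variable {X : Type*} [NormedAddCommGroup X] [NormedSpace ℝ X] [FiniteDimensional ℝ X]

/-- A germ of a `C¹` function extends to a globally `C¹` function. -/
theorem exists_contDiff_eventuallyEq {f : X → ℝ} {x : X} (hf : ContDiffAt ℝ 1 f x) :
    ∃ g : X → ℝ, ContDiff ℝ 1 g ∧ g =ᶠ[𝓝 x] f := by
  obtain ⟨r, hr, hball⟩ := Metric.nhds_basis_closedBall.mem_iff.1 (hf.eventually (by simp))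
  let χ : ContDiffBump x := ⟨r / 2, r, half_pos hr, half_lt_self hr⟩
  refine ⟨fun y => χ y * f y, contDiff_iff_contDiffAt.2 fun y => ?_, ?_⟩
  · by_cases hy : y ∈ tsupport χ
    · rw [χ.tsupport_eq] at hy
      exact χ.contDiff.contDiffAt.mul (hball hy)
    · refine (contDiffAt_const (c := (0 : ℝ))).congr_of_eventuallyEq ?_
      filter_upwards [(isClosed_tsupport χ).isOpen_compl.mem_nhds hy] with z hz
      rw [image_eq_zero_of_notMem_tsupport hz, zero_mul]
  · filter_upwards [χ.eventuallyEq_one] with y hy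
    rw [hy, Pi.one_apply, one_mul]

/-- The zero set of `Φ` near a zero with `∂Φ/∂t ≠ 0` is the graph of a `C¹` function. -/
theorem exists_graph {Φ : X × ℝ → ℝ} {p : X × ℝ} (hΦ : ContDiffAt ℝ 1 Φ p) (h0 : Φ p = 0)
    (ht : fderiv ℝ Φ p (0, 1) ≠ 0) :
    ∃ τ : X → ℝ, ContDiff ℝ 1 τ ∧ (∀ᶠ q in 𝓝 p, (Φ q = 0 ↔ q.2 = τ q.1)) ∧
      ∀ᶠ q in 𝓝 p, q.2 = τ q.1 → ∀ v : X × ℝ,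
        fderiv ℝ Φ q v = fderiv ℝ Φ q (0, 1) * (v.2 - fderiv ℝ τ q.1 v.1) := by
  have hinv : (fderiv ℝ Φ p ∘L .inr ℝ X ℝ).IsInvertible := by
    refine ⟨ContinuousLinearEquiv.unitsEquivAut ℝ (Units.mk0 _ ht), ?_⟩
    ext
    simp
  obtain ⟨τ, hτ, hτeq⟩ :=
    exists_contDiff_eventuallyEq (hΦ.contDiffAt_implicitFunction one_ne_zero hinv)
  have hfst : Tendsto (Prod.fst : X × ℝ → X) (𝓝 p) (𝓝 p.1) := continuous_fst.tendsto p
  refine ⟨τ, hτ, ?_, ?_⟩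
  · filter_upwards [hΦ.eventually_apply_eq_iff_implicitFunction one_ne_zero hinv,
      hfst.eventually hτeq] with q hq hq'
    rw [h0] at hq
    rw [hq, hq', eq_comm]
  · have hz : ∀ᶠ x in 𝓝 p.1, Φ (x, τ x) = 0 := by
      filter_upwards [hΦ.eventually_apply_implicitFunction one_ne_zero hinv, hτeq] with x hx hx'
      rw [hx', hx, h0]
    filter_upwards [hfst.eventually hz.eventually_nhds, hΦ.eventually (by simp)] with q hq hΦq hqτ v
    have hd : HasFDerivAt Φ (fderiv ℝ Φ q) (q.1, τ q.1) := by
      rw [← hqτ]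
      exact (hΦq.differentiableAt one_ne_zero).hasFDerivAt
    have hcomp := hd.comp q.1
      ((hasFDerivAt_id q.1).prodMk (hτ.differentiable one_ne_zero q.1).hasFDerivAt)
    have hzero : HasFDerivAt (Φ ∘ fun x => (id x, τ x)) (0 : X →L[ℝ] ℝ) q.1 :=
      (hasFDerivAt_const (0 : ℝ) q.1).congr_of_eventuallyEq hq
    have h1 := DFunLike.congr_fun (hcomp.unique hzero) v.1
    simp only [ContinuousLinearMap.comp_apply, ContinuousLinearMap.prod_apply,
      ContinuousLinearMap.id_apply, zero_apply] at h1
    -- The vector splits into a tangent vector of the graph, annihilated by the derivative of `Φ`,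
    -- and a vertical one.
    have h2 : v = (v.1, fderiv ℝ τ q.1 v.1) + (v.2 - fderiv ℝ τ q.1 v.1) • ((0 : X), (1 : ℝ)) := by
      ext <;> simp
    conv_lhs => rw [h2]
    rw [map_add, map_smul, h1, zero_add, smul_eq_mul, mul_comm]

end ImplicitGraph

/-! ### Wave fronts and the divergence equation across them -/

section Fronts

variable {N : ℕ} {c : ℝ}

theorem fderiv_apply_inl (Φ : Spacetime N → ℝ) (p : Spacetime N) (v : EuclideanSpace ℝ (Fin N)) :
    fderiv ℝ Φ p (v, 0) = ∑ j, v j * dx j Φ p := by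
  have hv : (v, (0 : ℝ)) = ∑ j, v j • (EuclideanSpace.single j (1 : ℝ), (0 : ℝ)) := by
    ext i
    · simp [Prod.fst_sum, Finset.sum_apply, Pi.single_apply]
    · simp [Prod.snd_sum]
  rw [hv, map_sum]
  exact Finset.sum_congr rfl fun j _ => by rw [map_smul, smul_eq_mul, dx]

theorem fderiv_apply_unitNormal {Φ : Spacetime N → ℝ} {p : Spacetime N} (h : gradX Φ p ≠ 0) :
    fderiv ℝ Φ p (unitNormal Φ p, 0) = ‖gradX Φ p‖ := by
  have hn : ‖gradX Φ p‖ ≠ 0 := norm_ne_zero_iff.2 h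
  rw [fderiv_apply_inl]
  have h1 : ∑ j, gradX Φ p j * gradX Φ p j = ‖gradX Φ p‖ ^ 2 := by
    rw [EuclideanSpace.real_norm_sq_eq]
    exact Finset.sum_congr rfl fun j _ => (sq _).symm
  calc ∑ j, unitNormal Φ p j * dx j Φ p
      = ‖gradX Φ p‖⁻¹ * ∑ j, gradX Φ p j * gradX Φ p j := by
        rw [Finset.mul_sum]
        refine Finset.sum_congr rfl fun j _ => ?_
        simp [unitNormal, gradX, mul_assoc]
    _ = ‖gradX Φ p‖ := by
        rw [h1]
        field_simp

theorem eventually_pos_of_hasDerivAt {f : ℝ → ℝ} {f' : ℝ} (hf : HasDerivAt f f' 0) (h0 : f 0 = 0)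
    (hf' : 0 < f') : ∀ᶠ s in 𝓝[>] 0, 0 < f s := by
  filter_upwards [hf.tendsto_slope_zero_right.eventually (lt_mem_nhds hf'), self_mem_nhdsWithin]
    with s hs hs0
  rw [zero_add, h0, sub_zero, smul_eq_mul] at hs
  exact (pos_iff_pos_of_mul_pos hs).1 (inv_pos.2 hs0)

namespace IsFrontEquation

variable {F : Set (Spacetime N)} {Φ : Spacetime N → ℝ} {p : Spacetime N}

theorem apply_eq_zero (h : IsFrontEquation c F Φ p) (hp : p ∈ F) : Φ p = 0 :=
  h.mem_iff.self_of_nhds.1 hp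

theorem dt_eq (h : IsFrontEquation c F Φ p) (hp : p ∈ F) : dt Φ p = -c * ‖gradX Φ p‖ :=
  h.characteristic.self_of_nhds hp

theorem dt_ne_zero (hc : 0 < c) (h : IsFrontEquation c F Φ p) (hp : p ∈ F) : dt Φ p ≠ 0 := by
  rw [h.dt_eq hp]
  exact mul_ne_zero (neg_ne_zero.2 hc.ne') (norm_ne_zero_iff.2 h.gradX_ne_zero)

/-- Each condition is open, the gradient being continuous for `C¹` functions. One `Φ` thus serves at
all nearby points. -/
theorem eventually (h : IsFrontEquation c F Φ p) : ∀ᶠ q in 𝓝 p, IsFrontEquation c F Φ q := by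
  have hd : ContinuousAt (fderiv ℝ Φ) p := (h.contDiffAt.fderiv_right (m := 0) le_rfl).continuousAt
  have hg : ContinuousAt (gradX Φ) p := by
    refine (PiLp.continuous_toLp 2 _).continuousAt.comp (continuousAt_pi.2 fun j => ?_)
    exact hd.clm_apply continuousAt_const
  filter_upwards [h.contDiffAt.eventually (by simp), h.mem_iff.eventually_nhds,
    hg.eventually_ne h.gradX_ne_zero, h.characteristic.eventually_nhds] with q h1 h2 h3 h4
  exact ⟨h1, h2, h3, h4⟩

/-- A function with limits from both sides of a front and without a jump across it has a limit. -/
theorem exists_tendsto_of_hasJump_zero (h : IsFrontEquation c F Φ p) (hp : p ∈ F)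
    {f : Spacetime N → ℝ} (hf : HasSideLimits f Φ p) (hj : HasJump f p (unitNormal Φ p) 0) :
    ∃ a, Tendsto f (𝓝[{q | Φ q ≠ 0}] p) (𝓝 a) := by
  obtain ⟨⟨a, ha⟩, b, hb⟩ := hf
  have hd := (h.contDiffAt.differentiableAt one_ne_zero).hasFDerivAt
  have hpos : 0 < ‖gradX Φ p‖ := norm_pos_iff.2 h.gradX_ne_zero
  have hline : ∀ v : EuclideanSpace ℝ (Fin N),
      HasDerivAt (fun s : ℝ => (p.1 + s • v, p.2)) (v, (0 : ℝ)) 0 := fun v => by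
    refine HasDerivAt.prodMk ?_ (hasDerivAt_const _ _)
    simpa using ((hasDerivAt_id (0 : ℝ)).smul_const v).const_add p.1
  have hΦline : ∀ v : EuclideanSpace ℝ (Fin N),
      HasDerivAt (fun s : ℝ => Φ (p.1 + s • v, p.2)) (fderiv ℝ Φ p (v, 0)) 0 := fun v =>
    HasFDerivAt.comp_hasDerivAt_of_eq (0 : ℝ) hd (hline v) (by simp)
  have hlim : ∀ v : EuclideanSpace ℝ (Fin N),
      Tendsto (fun s : ℝ => (p.1 + s • v, p.2)) (𝓝[>] 0) (𝓝 p) := fun v => by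
    have := (hline v).continuousAt.tendsto
    simp only [zero_smul, add_zero] at this
    exact this.mono_left nhdsWithin_le_nhds
  -- Along `n` the function `Φ` grows at rate `‖∇_x Φ‖ > 0`, so `p + s n` lies on the positive side
  -- and `p - s n` on the negative one. The jump is then the difference of the side limits.
  have hplus : Tendsto (fun s : ℝ => f (p.1 + s • unitNormal Φ p, p.2)) (𝓝[>] 0) (𝓝 a) := by
    refine ha.comp (tendsto_nhdsWithin_iff.2 ⟨hlim _, ?_⟩)
    refine eventually_pos_of_hasDerivAt (hΦline _) (by simpa using h.apply_eq_zero hp) ?_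
    rwa [fderiv_apply_unitNormal h.gradX_ne_zero]
  have hminus : Tendsto (fun s : ℝ => f (p.1 - s • unitNormal Φ p, p.2)) (𝓝[>] 0) (𝓝 b) := by
    have hm : ∀ s : ℝ, p.1 - s • unitNormal Φ p = p.1 + s • -unitNormal Φ p := fun s => by
      rw [smul_neg, sub_eq_add_neg]
    simp only [hm]
    refine hb.comp (tendsto_nhdsWithin_iff.2 ⟨hlim _, ?_⟩)
    have h1 := eventually_pos_of_hasDerivAt (hΦline (-unitNormal Φ p)).neg
      (by simpa using h.apply_eq_zero hp) (by
        have : (-unitNormal Φ p, (0 : ℝ)) = -(unitNormal Φ p, (0 : ℝ)) := by simp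
        rwa [this, map_neg, neg_neg, fderiv_apply_unitNormal h.gradX_ne_zero])
    filter_upwards [h1] with s hs
    exact neg_pos.1 hs
  have hab : a - b = 0 := tendsto_nhds_unique (hplus.sub hminus) hj
  obtain rfl : a = b := sub_eq_zero.1 hab
  refine ⟨a, ?_⟩
  have : {q | Φ q ≠ 0} = {q | 0 < Φ q} ∪ {q | Φ q < 0} := by
    ext q
    exact ne_iff_lt_or_gt.trans or_comm
  rw [this, nhdsWithin_union]
  exact ha.sup hb

end IsFrontEquation

/-- The points that lie on exactly one front and are smooth points of it. -/
def regularSet (c : ℝ) (F : ℕ → Set (Spacetime N)) : Set (Spacetime N) :=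
  {p | ∃ k, p ∈ F k ∧ (∀ l, l ≠ k → p ∉ F l) ∧ ∃ Φ, IsFrontEquation c (F k) Φ p}

variable {F : ℕ → Set (Spacetime N)}

theorem eventually_notMem_of_locallyFinite (hF : ∀ k, IsClosed (F k)) (hlf : LocallyFinite F)
    {k : ℕ} {p : Spacetime N} (hp : ∀ l, l ≠ k → p ∉ F l) :
    ∀ᶠ q in 𝓝 p, ∀ l, l ≠ k → q ∉ F l := by
  have hcl : IsClosed (⋃ l : {l // l ≠ k}, F l) :=
    (hlf.comp_injective Subtype.val_injective).isClosed_iUnion fun l => hF l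
  have hpc : p ∉ ⋃ l : {l // l ≠ k}, F l := by
    simpa using hp
  filter_upwards [hcl.isOpen_compl.mem_nhds hpc] with q hq
  simpa using hq

/-- By local finiteness the other fronts stay away from a regular point, and smoothness persists
nearby, so regular points are relatively open in the union. -/
theorem isClosed_iUnion_diff_regularSet (hF : ∀ k, IsClosed (F k)) (hlf : LocallyFinite F) :
    IsClosed ((⋃ k, F k) \ regularSet c F) := by
  rw [← isOpen_compl_iff, isOpen_iff_mem_nhds]
  intro p hp
  by_cases hpZ : p ∈ ⋃ k, F k
  · obtain ⟨k, -, hl, Φ, hΦ⟩ : p ∈ regularSet c F := by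
      by_contra hr
      exact hp ⟨hpZ, hr⟩
    filter_upwards [eventually_notMem_of_locallyFinite hF hlf hl, hΦ.eventually] with q hq hΦq
    rintro ⟨hqZ, hqr⟩
    obtain ⟨j, hj⟩ := Set.mem_iUnion.1 hqZ
    obtain rfl : j = k := by
      by_contra hjk
      exact hq j hjk hj
    exact hqr ⟨j, hj, hq, Φ, hΦq⟩
  · filter_upwards [(hlf.isClosed_iUnion hF).isOpen_compl.mem_nhds hpZ] with q hq hq'
    exact hq hq'.1

/-- A nonregular point is a singular point of some front or lies on two fronts; countably many null
sets cover all of these. -/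
theorem hausdorffMeasure_iUnion_diff_regularSet (hF : ∀ k, IsWaveFront c (F k))
    (hinter : ∀ k l, k ≠ l → Measure.hausdorffMeasure (N : ℝ) (F k ∩ F l) = 0) :
    Measure.hausdorffMeasure (N : ℝ) ((⋃ k, F k) \ regularSet c F) = 0 := by
  have hsub : (⋃ k, F k) \ regularSet c F ⊆
      (⋃ k, F k \ smoothPart c (F k)) ∪ ⋃ k, ⋃ l, ⋃ _ : k ≠ l, F k ∩ F l := by
    rintro p ⟨hpZ, hpr⟩
    obtain ⟨k, hk⟩ := Set.mem_iUnion.1 hpZ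
    by_contra hcon
    simp only [Set.mem_union, Set.mem_iUnion, not_or, not_exists] at hcon
    refine hpr ⟨k, hk, fun l hl hpl => hcon.2 k l hl.symm ⟨hk, hpl⟩, ?_⟩
    by_contra hsm
    exact hcon.1 k ⟨hk, fun h => hsm h.2⟩
  refine measure_mono_null hsub (measure_union_null ?_ ?_)
  · exact measure_iUnion_null fun k => (hF k).singular_null
  · exact measure_iUnion_null fun k => measure_iUnion_null fun l =>
      measure_iUnion_null fun hkl => hinter k l hkl

theorem finrank_spacetime : Module.finrank ℝ (Spacetime N) = N + 1 := by
  simp [Spacetime]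

instance : (volume : Measure (Spacetime N)).IsAddHaarMeasure :=
  inferInstanceAs ((volume : Measure (EuclideanSpace ℝ (Fin N))).prod
    (volume : Measure ℝ)).IsAddHaarMeasure

/-- Nullity passes to the higher dimension `N + 1`, where Hausdorff measure is a Haar measure. -/
theorem volume_eq_zero_of_hausdorffMeasure_eq_zero {B : Set (Spacetime N)}
    (h : Measure.hausdorffMeasure (N : ℝ) B = 0) : volume B = 0 := by
  have h1 : Measure.hausdorffMeasure (Module.finrank ℝ (Spacetime N) : ℝ) B = 0 := by
    refine le_antisymm ((Measure.hausdorffMeasure_mono ?_ B).trans h.le) zero_le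
    rw [finrank_spacetime]
    push_cast
    linarith
  exact Measure.absolutelyContinuous_isAddHaarMeasure volume
    (Measure.hausdorffMeasure (Module.finrank ℝ (Spacetime N) : ℝ)) h1

theorem volume_iUnion_eq_zero (hc : 0 < c) (hF : ∀ k, IsWaveFront c (F k)) (hlf : LocallyFinite F)
    (hinter : ∀ k l, k ≠ l → Measure.hausdorffMeasure (N : ℝ) (F k ∩ F l) = 0) :
    volume (⋃ k, F k) = 0 := by
  have hcl : ∀ k, IsClosed (F k) := fun k => by
    rw [(hF k).eq_closure]
    exact isClosed_closure
  have hreg : volume (regularSet c F) = 0 := by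
    refine measure_null_of_locally_null _ fun p hp => ?_
    obtain ⟨k, hk, hl, Φ, hΦ⟩ := hp
    obtain ⟨τ, hτ, hgraph, -⟩ := exists_graph hΦ.contDiffAt (hΦ.apply_eq_zero hk)
      (hΦ.dt_ne_zero hc hk)
    refine ⟨{q | q.2 = τ q.1}, ?_, measure_graph_eq_zero hτ.continuous⟩
    filter_upwards [mem_nhdsWithin_of_mem_nhds hgraph, mem_nhdsWithin_of_mem_nhds hΦ.mem_iff,
      mem_nhdsWithin_of_mem_nhds (eventually_notMem_of_locallyFinite hcl hlf hl),
      self_mem_nhdsWithin] with q h1 h2 h3 h4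
    obtain ⟨j, hj, -⟩ := h4
    obtain rfl : j = k := by
      by_contra hjk
      exact h3 j hjk hj
    exact h1.1 (h2.1 hj)
  refine measure_mono_null (t := ((⋃ k, F k) \ regularSet c F) ∪ regularSet c F)
    (fun p hp => ?_) (measure_union_null (volume_eq_zero_of_hausdorffMeasure_eq_zero
      (hausdorffMeasure_iUnion_diff_regularSet hF hinter)) hreg)
  by_cases h : p ∈ regularSet c F
  · exact Or.inr h
  · exact Or.inl ⟨hp, h⟩

/-- A function that is continuous and locally bounded off a closed null set is locally
integrable. -/
theorem locallyIntegrable_of_continuousOn_compl {Z : Set (Spacetime N)} (hZ : IsClosed Z)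
    (hZ0 : volume Z = 0) {f : Spacetime N → ℝ} (hf : ContinuousOn f Zᶜ)
    (hb : ∀ p, ∃ M : ℝ, ∀ᶠ q in 𝓝 p, q ∉ Z → |f q| ≤ M) : LocallyIntegrable f := by
  have hae : ∀ᵐ q : Spacetime N, q ∈ Zᶜ := measure_eq_zero_iff_ae_notMem.1 hZ0
  have hm : AEStronglyMeasurable f := by
    have := hf.aestronglyMeasurable (μ := volume) hZ.isOpen_compl.measurableSet
    rwa [Measure.restrict_eq_self_of_ae_mem hae] at this
  intro p
  obtain ⟨M, hM⟩ := hb p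
  obtain ⟨r, hr, hball⟩ := Metric.nhds_basis_closedBall.mem_iff.1 hM
  refine ⟨Metric.closedBall p r, Metric.closedBall_mem_nhds p hr, ?_⟩
  refine IntegrableOn.of_bound (isCompact_closedBall p r).measure_lt_top hm.restrict M ?_
  filter_upwards [ae_restrict_of_ae hae, ae_restrict_mem Metric.isClosed_closedBall.measurableSet]
    with q hq hqr using hball hqr hq

variable {ι : Type*} [Fintype ι] {f : ι → Spacetime N → ℝ} {e : ι → Spacetime N}
  {g ψ : Spacetime N → ℝ}

/-- A piecewise `C¹` field whose normal component is continuous across the wave fronts satisfies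
the divergence equation in the sense of generalized functions. -/
theorem divPairing_eq_zero_of_fronts (hc : 0 < c) (hF : ∀ k, IsWaveFront c (F k))
    (hlf : LocallyFinite F)
    (hinter : ∀ k l, k ≠ l → Measure.hausdorffMeasure (N : ℝ) (F k ∩ F l) = 0)
    (hf : ∀ i, ContDiffOn ℝ 1 (f i) (⋃ k, F k)ᶜ)
    (hfb : ∀ p, ∃ M : ℝ, ∀ᶠ q in 𝓝 p, q ∉ ⋃ k, F k → ∀ i, |f i q| ≤ M)
    (hgl : LocallyIntegrable g)
    (hg : ∀ p ∉ ⋃ k, F k, g p = ∑ i, fderiv ℝ (f i) p (e i))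
    (hflux : ∀ k, ∀ p ∈ F k, (∀ l, l ≠ k → p ∉ F l) → ∀ Φ, IsFrontEquation c (F k) Φ p →
      ∃ a, Tendsto (fun q => ∑ i, f i q * fderiv ℝ Φ p (e i)) (𝓝[{q | Φ q ≠ 0}] p) (𝓝 a))
    (hψ : ContDiff ℝ 1 ψ) (hψc : HasCompactSupport ψ) : divPairing volume f e g ψ = 0 := by
  have hcl : ∀ k, IsClosed (F k) := fun k => by
    rw [(hF k).eq_closure]
    exact isClosed_closure
  have hZcl : IsClosed (⋃ k, F k) := hlf.isClosed_iUnion hcl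
  have hZ0 : volume (⋃ k, F k) = 0 := volume_iUnion_eq_zero hc hF hlf hinter
  have hfl : ∀ i, LocallyIntegrable (f i) := fun i =>
    locallyIntegrable_of_continuousOn_compl hZcl hZ0 (hf i).continuousOn fun p => by
      obtain ⟨M, hM⟩ := hfb p
      exact ⟨M, hM.mono fun q hq hqZ => hq hqZ i⟩
  -- Once the exceptional set is removed, each remaining point has a neighbourhood meeting either no
  -- front or a single graph.
  refine divPairing_eq_zero_of_hausdorffMeasure_eq_zero finrank_spacetime hZ0 hfl hfb hgl
    (isClosed_iUnion_diff_regularSet (c := c) hcl hlf)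
    (hausdorffMeasure_iUnion_diff_regularSet hF hinter) (fun φ hφ hφc hφs => ?_) hψ hψc
  refine contDiff_compactSupport_induction (P := fun φ => divPairing volume f e g φ = 0)
    (by simp [divPairing]) ?_ ?_ hφ hφc hφs
  · intro φ₁ φ₂ h1 h1c h2 h2c h10 h20
    rw [divPairing_add hfl hgl h1 h1c h2 h2c, h10, h20, add_zero]
  intro p hp
  by_cases hpZ : p ∈ ⋃ k, F k
  swap
  · exact ⟨_, hZcl.isOpen_compl.mem_nhds hpZ, fun φ hφ hφc hφs =>
      divPairing_eq_zero_of_contDiffOn hZcl.isOpen_compl hf hg hφ hφc hφs⟩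
  obtain ⟨k, hk, hl, Φ, hΦ⟩ : p ∈ regularSet c F := by
    by_contra hr
    exact hp ⟨hpZ, hr⟩
  obtain ⟨τ, hτ, hgraph, hderiv⟩ := exists_graph hΦ.contDiffAt (hΦ.apply_eq_zero hk)
    (hΦ.dt_ne_zero hc hk)
  obtain ⟨M, hM⟩ := hfb p
  obtain ⟨U, hUsub, hU, hpU⟩ := eventually_nhds_iff.1 (hgraph.and (hderiv.and (hM.and
    (hΦ.eventually.and (hΦ.mem_iff.and (eventually_notMem_of_locallyFinite hcl hlf hl))))))
  have hmem : ∀ q ∈ U, (q ∈ ⋃ k, F k) ↔ q.2 = τ q.1 := fun q hq => by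
    obtain ⟨h1, -, -, -, h5, h6⟩ := hUsub q hq
    rw [← h1, ← h5]
    refine ⟨fun h => ?_, fun h => Set.mem_iUnion.2 ⟨k, h⟩⟩
    obtain ⟨j, hj⟩ := Set.mem_iUnion.1 h
    obtain rfl : j = k := by
      by_contra hjk
      exact h6 j hjk hj
    exact hj
  refine ⟨U, hU.mem_nhds hpU, fun φ hφ hφc hφs => ?_⟩
  refine divPairing_eq_zero_of_graph (μ := volume) hτ hU hfl hgl
    (fun i => (hf i).mono fun q hq hqZ => hq.2 ((hmem q hq.1).1 hqZ)) (M := M)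
    (fun q hq hqτ => (hUsub q hq).2.2.1 fun h => hqτ ((hmem q hq).1 h))
    (fun q hq hqτ => hg q fun h => hqτ ((hmem q hq).1 h)) ?_ hφ hφc hφs
  intro q hq hqτ
  obtain ⟨h1, h2, -, h4, h5, h6⟩ := hUsub q hq
  have hqF : q ∈ F k := h5.2 (h1.2 hqτ)
  obtain ⟨a, ha⟩ := hflux k q hqF h6 Φ h4
  have ht : fderiv ℝ Φ q (0, 1) ≠ 0 := h4.dt_ne_zero hc hqF
  -- The conormal of the graph is the derivative of `Φ` divided by `Φ_t`.
  refine ⟨(fderiv ℝ Φ q (0, 1))⁻¹ * a, ((ha.const_mul _).mono_left ?_).congr fun y => ?_⟩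
  · rw [nhdsWithin_le_iff]
    filter_upwards [self_mem_nhdsWithin, mem_nhdsWithin_of_mem_nhds (hU.mem_nhds hq)] with y hy hyU
    exact fun h => hy ((hUsub y hyU).1.1 h)
  · rw [Finset.mul_sum]
    refine Finset.sum_congr rfl fun i _ => ?_
    rw [h2 hqτ (e i)]
    field_simp

end Fronts

/-! ### Classical solutions and Hadamard's conditions -/

section ClassicalSolutions

variable {N : ℕ} {c : ℝ}

theorem HasSideLimits.map {Y Y' : Type*} [TopologicalSpace Y] [TopologicalSpace Y']
    {f : Spacetime N → Y} {Φ : Spacetime N → ℝ} {p : Spacetime N} (hf : HasSideLimits f Φ p)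
    {L : Y → Y'} (hL : Continuous L) : HasSideLimits (fun q => L (f q)) Φ p := by
  obtain ⟨⟨a, ha⟩, b, hb⟩ := hf
  exact ⟨⟨L a, (hL.tendsto a).comp ha⟩, L b, (hL.tendsto b).comp hb⟩

namespace IsTestFunction

variable {φ : Spacetime N → ℝ}

theorem contDiff_one (hφ : IsTestFunction φ) : ContDiff ℝ 1 φ :=
  hφ.1.of_le (by exact_mod_cast le_top)

theorem fderiv_apply (hφ : IsTestFunction φ) (v : Spacetime N) :
    IsTestFunction fun p => fderiv ℝ φ p v :=
  ⟨(hφ.1.fderiv_right (m := ∞) (by simp)).clm_apply contDiff_const, hφ.2.fderiv_apply ℝ v⟩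

theorem integrable_mul {f : Spacetime N → ℝ} (hf : LocallyIntegrable f) (hφ : IsTestFunction φ) :
    Integrable fun p => f p * φ p :=
  hf.integrable_smul_right_of_hasCompactSupport hφ.1.continuous hφ.2

end IsTestFunction

namespace IsClassicalSolutionWithFronts

variable {G u : Spacetime N → ℝ} {F : ℕ → Set (Spacetime N)}

theorem isClosed_iUnion (h : IsClassicalSolutionWithFronts c G u F) : IsClosed (⋃ k, F k) :=
  h.locallyFinite.isClosed_iUnion fun k => by
    rw [(h.isWaveFront k).eq_closure]
    exact isClosed_closure

theorem volume_iUnion (hc : 0 < c) (h : IsClassicalSolutionWithFronts c G u F) :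
    volume (⋃ k, F k) = 0 :=
  volume_iUnion_eq_zero hc h.isWaveFront h.locallyFinite h.inter_null

theorem locallyIntegrable (hc : 0 < c) (h : IsClassicalSolutionWithFronts c G u F) :
    LocallyIntegrable u :=
  locallyIntegrable_of_continuousOn_compl h.isClosed_iUnion (h.volume_iUnion hc)
    h.contDiffOn.continuousOn fun p => by
      obtain ⟨M, hM⟩ := h.locallyBounded p
      exact ⟨M, hM.mono fun q hq hqZ => (hq hqZ).1⟩

theorem contDiffOn_fderiv_apply (h : IsClassicalSolutionWithFronts c G u F) (v : Spacetime N) :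
    ContDiffOn ℝ 1 (fun p => fderiv ℝ u p v) (⋃ k, F k)ᶜ :=
  (h.contDiffOn.fderiv_of_isOpen h.isClosed_iUnion.isOpen_compl (m := 1) (by norm_num)).clm_apply
    contDiffOn_const

theorem eventually_abs_fderiv_apply_le (h : IsClassicalSolutionWithFronts c G u F)
    (p : Spacetime N) : ∃ M : ℝ, ∀ᶠ q in 𝓝 p, q ∉ ⋃ k, F k → ∀ v, |fderiv ℝ u q v| ≤ M * ‖v‖ := by
  obtain ⟨M, hM⟩ := h.locallyBounded p
  exact ⟨M, hM.mono fun q hq hqZ v => ContinuousLinearMap.le_of_opNorm_le _ (hq hqZ).2 v⟩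

theorem locallyIntegrable_fderiv_apply (hc : 0 < c) (h : IsClassicalSolutionWithFronts c G u F)
    (v : Spacetime N) : LocallyIntegrable fun p => fderiv ℝ u p v :=
  locallyIntegrable_of_continuousOn_compl h.isClosed_iUnion (h.volume_iUnion hc)
    (h.contDiffOn_fderiv_apply v).continuousOn fun p => by
      obtain ⟨M, hM⟩ := h.eventually_abs_fderiv_apply_le p
      exact ⟨M * ‖v‖, hM.mono fun q hq hqZ => hq hqZ v⟩

/-- The pointwise first derivatives of a classical solution are its generalized derivatives. -/
theorem pairing_fderiv_apply (hc : 0 < c) (h : IsClassicalSolutionWithFronts c G u F)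
    (v : Spacetime N) {φ : Spacetime N → ℝ} (hφ : IsTestFunction φ) :
    pairing u (fun p => fderiv ℝ φ p v) = -pairing (fun p => fderiv ℝ u p v) φ := by
  have hvi := h.locallyIntegrable_fderiv_apply hc v
  have h0 := divPairing_eq_zero_of_fronts (f := fun _ : Unit => u) (e := fun _ => v)
    (g := fun p => fderiv ℝ u p v) hc h.isWaveFront h.locallyFinite h.inter_null
    (fun _ => h.contDiffOn.of_le one_le_two)
    (fun p => by
      obtain ⟨M, hM⟩ := h.locallyBounded p
      exact ⟨M, hM.mono fun q hq hqZ _ => (hq hqZ).1⟩)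
    hvi (fun p _ => by simp)
    (fun k p hp hl Φ hΦ => by
      obtain ⟨a, ha⟩ := hΦ.exists_tendsto_of_hasJump_zero hp (h.sideLimits k p hp hl Φ hΦ).1
        (h.hadamard k p hp hl Φ hΦ).jump_zero
      exact ⟨a * fderiv ℝ Φ p v, by simpa using ha.mul_const (fderiv ℝ Φ p v)⟩)
    hφ.contDiff_one hφ.2
  simp only [divPairing, Finset.univ_unique, Finset.sum_const, Finset.card_singleton, one_smul]
    at h0
  rw [integral_add ((hφ.fderiv_apply v).integrable_mul (h.locallyIntegrable hc))
    (hφ.integrable_mul hvi)] at h0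
  exact eq_neg_of_add_eq_zero_left h0

/-- The normal component of `(∇u, -c⁻² u_t)` has a limit on the fronts by Hadamard's condition. -/
theorem exists_tendsto_flux (hc : 0 < c) (h : IsClassicalSolutionWithFronts c G u F)
    {k : ℕ} {p : Spacetime N} (hp : p ∈ F k) (hl : ∀ l, l ≠ k → p ∉ F l) {Φ : Spacetime N → ℝ}
    (hΦ : IsFrontEquation c (F k) Φ p) :
    ∃ a, Tendsto (fun q => -(1 / c ^ 2) * dt u q * dt Φ p + ∑ j, dx j u q * dx j Φ p)
      (𝓝[{q | Φ q ≠ 0}] p) (𝓝 a) := by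
  -- The normal is frozen at `p`, so Hadamard's quantity is a continuous function of the derivative
  -- of `u` and inherits its side limits.
  have hL : Continuous fun A : Spacetime N →L[ℝ] ℝ => A (0, 1) + c * ∑ i : Fin N,
      unitNormal Φ p i * A (EuclideanSpace.single i 1, 0) := by fun_prop
  obtain ⟨a, ha⟩ := hΦ.exists_tendsto_of_hasJump_zero hp
    ((h.sideLimits k p hp hl Φ hΦ).2.map hL) (h.hadamard k p hp hl Φ hΦ).jump_deriv_zero
  have hn : ‖gradX Φ p‖ ≠ 0 := norm_ne_zero_iff.2 hΦ.gradX_ne_zero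
  have hdx : ∀ j, dx j Φ p = ‖gradX Φ p‖ * unitNormal Φ p j := fun j => by
    rw [unitNormal, PiLp.smul_apply, smul_eq_mul, mul_inv_cancel_left₀ hn, gradX]
  -- The factor comes from `-c⁻² Φ_t = ‖∇_x Φ‖ / c`.
  refine ⟨‖gradX Φ p‖ / c * a, (ha.const_mul _).congr fun q => ?_⟩
  change ‖gradX Φ p‖ / c * (dt u q + c * ∑ i : Fin N, unitNormal Φ p i * dx i u q) = _
  have hsum : ∑ j, dx j u q * dx j Φ p = ‖gradX Φ p‖ * ∑ i, unitNormal Φ p i * dx i u q := by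
    rw [Finset.mul_sum]
    exact Finset.sum_congr rfl fun j _ => by rw [hdx]; ring
  rw [hsum, hΦ.dt_eq hp]
  field_simp

/-- The energy form of the wave equation. -/
theorem sum_pairing_dx_sub_pairing_dt (hc : 0 < c) (hG : LocallyIntegrable G)
    (h : IsClassicalSolutionWithFronts c G u F) {φ : Spacetime N → ℝ} (hφ : IsTestFunction φ) :
    ∑ j, pairing (dx j u) (dx j φ) - 1 / c ^ 2 * pairing (dt u) (dt φ) = -pairing G φ := by
  -- The index `none` stands for the time component of the field.
  let f : Option (Fin N) → Spacetime N → ℝ := fun o =>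
    o.elim (fun q => -(1 / c ^ 2) * dt u q) fun j => dx j u
  let e : Option (Fin N) → Spacetime N := fun o =>
    o.elim (0, 1) fun j => (EuclideanSpace.single j 1, 0)
  have hdt : ContDiffOn ℝ 1 (dt u) (⋃ k, F k)ᶜ := h.contDiffOn_fderiv_apply (0, 1)
  have h0 : divPairing volume f e G φ = 0 := by
    refine divPairing_eq_zero_of_fronts hc h.isWaveFront h.locallyFinite h.inter_null
      ?_ ?_ hG ?_ ?_ hφ.contDiff_one hφ.2
    · rintro (_ | j)
      · exact contDiffOn_const.mul hdt
      · exact h.contDiffOn_fderiv_apply _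
    · intro p
      obtain ⟨M, hM⟩ := h.eventually_abs_fderiv_apply_le p
      refine ⟨max (|(-(1 / c ^ 2))| * (M * ‖((0, 1) : Spacetime N)‖)) M,
        hM.mono fun q hq hqZ => ?_⟩
      rintro (_ | j)
      · refine le_trans ?_ (le_max_left _ _)
        change |-(1 / c ^ 2) * dt u q| ≤ _
        rw [abs_mul]
        exact mul_le_mul_of_nonneg_left (hq hqZ _) (abs_nonneg _)
      · refine le_trans ?_ (le_max_right _ _)
        have := hq hqZ (EuclideanSpace.single j 1, 0)
        rw [Prod.norm_mk, norm_zero, PiLp.norm_single, norm_one,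
          max_eq_left zero_le_one, mul_one] at this
        exact this
    · intro p hp
      rw [← h.equation p hp, Fintype.sum_option]
      have hd : DifferentiableAt ℝ (dt u) p :=
        (hdt.contDiffAt (h.isClosed_iUnion.isOpen_compl.mem_nhds hp)).differentiableAt one_ne_zero
      have h1 : fderiv ℝ (f none) p (e none) = -(1 / c ^ 2) * dt (dt u) p := by
        change fderiv ℝ (fun q => -(1 / c ^ 2) * dt u q) p (0, 1) = _
        rw [fderiv_const_mul hd]
        rfl
      rw [h1, box, sub_eq_neg_add, neg_mul]
      rfl
    · intro k p hp hl Φ hΦ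
      obtain ⟨a, ha⟩ := h.exists_tendsto_flux hc hp hl hΦ
      refine ⟨a, ha.congr fun q => ?_⟩
      rw [Fintype.sum_option]
      rfl
  have hit : Integrable fun p => dt u p * dt φ p :=
    (hφ.fderiv_apply _).integrable_mul (h.locallyIntegrable_fderiv_apply hc _)
  have hix : ∀ j, Integrable fun p => dx j u p * dx j φ p := fun j =>
    (hφ.fderiv_apply _).integrable_mul (h.locallyIntegrable_fderiv_apply hc _)
  have hexp : ∀ p, (∑ i, f i p * fderiv ℝ φ p (e i)) + G p * φ p =
      (-(1 / c ^ 2) * (dt u p * dt φ p) + ∑ j, dx j u p * dx j φ p) + G p * φ p := fun p => by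
    rw [Fintype.sum_option, ← mul_assoc]
    rfl
  simp only [divPairing, hexp] at h0
  have hixs : Integrable fun p => ∑ j, dx j u p * dx j φ p :=
    integrable_finsetSum _ fun j _ => hix j
  have hsum : Integrable fun p =>
      -(1 / c ^ 2) * (dt u p * dt φ p) + ∑ j, dx j u p * dx j φ p := (hit.const_mul _).add hixs
  rw [integral_add hsum (hφ.integrable_mul hG), integral_add (hit.const_mul _) hixs, integral_const_mul,
    integral_finsetSum _ fun j _ => hix j] at h0
  simp only [pairing]
  linarith

/-- The derivatives of `φ` are again test functions, so one derivative moves onto `u` without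
layers, and the energy form handles the other. -/
theorem pairing_box (hc : 0 < c) (hG : LocallyIntegrable G)
    (h : IsClassicalSolutionWithFronts c G u F) {φ : Spacetime N → ℝ} (hφ : IsTestFunction φ) :
    pairing u (box c φ) = pairing G φ := by
  have hu := h.locallyIntegrable hc
  have hx : ∀ j, IsTestFunction (dx j φ) := fun j => hφ.fderiv_apply _
  have ht : IsTestFunction (dt φ) := hφ.fderiv_apply _
  have hix : ∀ j, Integrable fun p => u p * dx j (dx j φ) p := fun j =>
    ((hx j).fderiv_apply _).integrable_mul hu
  have hit : Integrable fun p => u p * dt (dt φ) p := (ht.fderiv_apply _).integrable_mul hu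
  have h1 : pairing u (box c φ) =
      ∑ j, pairing u (dx j (dx j φ)) - 1 / c ^ 2 * pairing u (dt (dt φ)) := by
    simp only [pairing, box, mul_sub, Finset.mul_sum, mul_left_comm (u _) (1 / c ^ 2)]
    rw [integral_sub (integrable_finsetSum _ fun j _ => hix j) (hit.const_mul _),
      integral_finsetSum _ fun j _ => hix j, integral_const_mul]
  have h2 : ∀ j, pairing u (dx j (dx j φ)) = -pairing (dx j u) (dx j φ) := fun j =>
    h.pairing_fderiv_apply hc _ (hx j)
  have h3 : pairing u (dt (dt φ)) = -pairing (dt u) (dt φ) := h.pairing_fderiv_apply hc _ ht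
  have h4 := h.sum_pairing_dx_sub_pairing_dt hc hG hφ
  rw [h1, h3]
  simp only [h2, Finset.sum_neg_distrib]
  linarith

theorem ae_box_eq (hc : 0 < c) (h : IsClassicalSolutionWithFronts c G u F) :
    box c u =ᵐ[volume] G := by
  filter_upwards [measure_eq_zero_iff_ae_notMem.1 (h.volume_iUnion hc)] with p hp
    using h.equation p hp

end IsClassicalSolutionWithFronts

end ClassicalSolutions

end WaveEq

/-- A classical solution `u` of `□_c u = G`, `G` locally integrable, is a generalized solution.
Moreover, the generalized first derivatives of `u` and its generalized `□_c u` are the regular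
generalized functions of the pointwise ones, so that all singular layers vanish. -/
theorem lemma1p1 {N : ℕ} (hN : 1 ≤ N) {c : ℝ} (hc : 0 < c)
    {G u : WaveEq.Spacetime N → ℝ} (hG : MeasureTheory.LocallyIntegrable G)
    (hu : WaveEq.IsClassicalSolution c G u) :
    WaveEq.IsGeneralizedSolution c G u ∧
      (∀ j : Fin N, WaveEq.NoLayers (WaveEq.dx j) u) ∧
      WaveEq.NoLayers WaveEq.dt u ∧
      WaveEq.IsGeneralizedSolution c (WaveEq.box c u) u := by
  obtain ⟨F, h⟩ := hu
  have hbox := h.ae_box_eq hc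
  refine ⟨⟨h.locallyIntegrable hc, hG, fun φ hφ => h.pairing_box hc hG hφ⟩,
    fun j => ⟨h.locallyIntegrable_fderiv_apply hc _, fun φ hφ => h.pairing_fderiv_apply hc _ hφ⟩,
    ⟨h.locallyIntegrable_fderiv_apply hc _, fun φ hφ => h.pairing_fderiv_apply hc _ hφ⟩,
    -- The pointwise `□_c u` agrees with `G` off the null set of fronts, so its values there do not
    -- matter.
    ⟨h.locallyIntegrable hc, hG.congr hbox.symm, fun φ hφ => ?_⟩⟩
  rw [h.pairing_box hc hG hφ]
  refine integral_congr_ae ?_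
  filter_upwards [hbox] with p hp
  rw [hp]
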